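/- Let $\mathcal Y\subseteq\mathbb R^I$, $c\in\mathbb R^I$, and let $\Xi_1,\dots,\Xi_L\subseteq\mathbb R^N$ be compact. For $y\in\mathcal Y$ and $\xi\in\Xi:=\bigcup_l\Xi_l$ let $$h(y,\xi)=\min_{x\in\mathbb R^J}\{(Q\xi+q)^{\mathsf T}x:\ T(y)\xi+Wx\ge R(y)\},$$ where $T(y)\in\mathbb R^{S\times N}$, $R(y)\in\mathbb R^S$ are affine in $y$, and assume that this linear program is feasible with finite value for all $y\in\mathcal Y$, $\xi\in\Xi$. Let $\rho\ge 0$, let $\hat p(y)\in\mathbb R^L_+$ with $\sum_l\hat p_l(y)=1$ for $y\in\mathcal Y$, let $f=(f_1,\dots,f_M)$ be real functions on $\mathbb R^N$, and let $\underline u_l(y),\bar u_l(y)\in\mathbb R^M$. Put $$\Delta(y)=\Big\{p\in\mathbb R^L_+:\ \sum_l p_l=1,\ \sum_l \tfrac{(p_l-\hat p_l(y))^2}{p_l}\le\rho\Big\}$$ (a term with $p_l=0$ is $0$ if $\hat p_l(y)=0$ and $+\infty$ otherwise), $$\mathcal U_l(y)=\Big\{\mathbb P\in\mathcal P(\Xi_l):\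 f_1,\dots,f_M \text{ are } \mathbb P\text{-integrable},\ \underline u_l(y)\le\int f\,d\mathbb P\le\bar u_l(y)\Big\},$$ and $\Theta(y)=\{\sum_l p_l\mathbb P_l:\ p\in\Delta(y),\ \mathbb P_l\in\mathcal U_l(y)\}$. The multimodal decision-dependent distributionally robust model is $$\text{(P)}\qquad \inf_{y\in\mathcal Y}\ c^{\mathsf T}y+\sup_{\mathbb P\in\Theta(y)}\mathbb E_{\mathbb P}[h(y,\xi)].$$ Say that $\mathcal U_l(y)$ has a relative interior point if some $\mathbb P\in\mathcal U_l(y)$ has its moment vector $\int f\,d\mathbb P$ in the relative interior of the box $[\underline u_l(y),\bar u_l(y)]$ and in the relative interior of the convex set of moment vectors of all probability measures on $\Xi_l$ that integrate $f$. Assume that for all $y\in\mathcal Y$ and all $l$, either $\mathcal U_l(y)$ has a relative interior point, or $f_1,\dots,f_M$ are continuous on $\Xi_l$ and $\mathcal U_l(y)$ is non-empty. Then (P) is equivalent to the semi-infinite second-order cone reformulation, with variables $y$, $\lambda,\eta\in\mathbb R$, $\psi,r,\alpha\in\mathbb R^L$, $\underline\beta_l,\bar\beta_l\in\mathbb R^M$,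 $$\begin{aligned}\text{(D)}\quad \inf\ & c^{\mathsf T}y+\eta+\rho\lambda+2\lambda-2\sum_{l=1}^L\hat p_l(y)r_l\\ \text{s.t. } & y\in\mathcal Y,\ \lambda\ge0,\ \underline\beta_l,\bar\beta_l\ge0 &&\forall l,\\ &\psi_l\ge\alpha_l+\bar\beta_l^{\mathsf T}\bar u_l(y)-\underline\beta_l^{\mathsf T}\underline u_l(y)&&\forall l,\\ &\sqrt{r_l^2+\tfrac14(\psi_l-\eta)^2}\le\lambda-\tfrac12(\psi_l-\eta)&&\forall l,\\ &\psi_l-\eta\le\lambda&&\forall l,\\ &\alpha_l+(\bar\beta_l-\underline\beta_l)^{\mathsf T}f(\xi)\ge h(y,\xi)&&\forall l,\ \forall\xi\in\Xi_l,\end{aligned}$$ in the following sense. (1) For every $y\in\mathcal Y$ the worst-case expectation in (P) is finite, and $c^{\mathsf T}y$ plus it equals the infimum of (D) over the remaining variables. (2) The optimal values of (P) and (D) in $[-\infty,\infty]$ coincide. (3) If $(y,\lambda,\eta,\psi,r,\alpha,\underline\beta,\bar\beta)$ is optimal for (D), then $y$ is optimal for (P). (4) If $\rho>0$ and, for some $y\in\mathcal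 Y$, every $\mathcal U_l(y)$ has a relative interior point, then the infimum of (D) over the remaining variables at this $y$ is attained, and $y$ is optimal for (P) if and only if it is part of an optimal solution of (D). -/

import Mathlib

open MeasureTheory
open scoped Matrix

noncomputable section

/-- The data of a two-stage multimodal decision-dependent distributionally robust problem with
`I` first-stage variables, `J` second-stage variables, `N` random parameters, `S` second-stage
constraints, `L` modes and `M` moment functions.  This is data only, without any law. -/
structure D3RO (I J N S L M : ℕ) where
  /-- first-stage cost vector -/
  c : Fin I → ℝ
  /-- first-stage feasible region -/
  Y : Set (Fin I → ℝ)
  /-- second-stage cost `Q ξ + q` -/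
  Q : Matrix (Fin J) (Fin N) ℝ
  q : Fin J → ℝ
  /-- second-stage constraints `T(y) ξ + W x ≥ R(y)` -/
  T : (Fin I → ℝ) →ᵃ[ℝ] Matrix (Fin S) (Fin N) ℝ
  W : Matrix (Fin S) (Fin J) ℝ
  R : (Fin I → ℝ) →ᵃ[ℝ] (Fin S → ℝ)
  /-- support set of each mode -/
  Xi : Fin L → Set (Fin N → ℝ)
  /-- decision-dependent reference mode probabilities -/
  phat : (Fin I → ℝ) → Fin L → ℝ
  /-- robustness level of the mode probabilities -/
  rho : ℝ
  /-- moment functions -/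
  f : Fin M → (Fin N → ℝ) → ℝ
  /-- decision-dependent lower and upper bounds on the moments -/
  uLo : (Fin I → ℝ) → Fin L → Fin M → ℝ
  uHi : (Fin I → ℝ) → Fin L → Fin M → ℝ

namespace D3RO

variable {I J N S L M : ℕ} (D : D3RO I J N S L M)

/-- Feasible region of the second-stage problem. -/
def secondStageSet (y : Fin I → ℝ) (ξ : Fin N → ℝ) : Set (Fin J → ℝ) :=
  {x | D.R y ≤ D.T y *ᵥ ξ + D.W *ᵥ x}

/-- Second-stage objective `(Q ξ + q)ᵀ x`. -/
def secondStageCost (ξ : Fin N → ℝ) (x : Fin J → ℝ) : ℝ :=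
  (D.Q *ᵥ ξ + D.q) ⬝ᵥ x

/-- Optimal value `h(y, ξ)` of the second-stage linear program (meaningful when the program is
feasible and bounded below). -/
def h (y : Fin I → ℝ) (ξ : Fin N → ℝ) : ℝ :=
  sInf (D.secondStageCost ξ '' D.secondStageSet y ξ)

/-- The `χ²`-distance set of mode probabilities around `phat y`.  A term
`(pₗ - p̂ₗ)² / pₗ` with `pₗ = 0` is `+∞` if `p̂ₗ ≠ 0` (so such a `p` is excluded) and `0` if
`p̂ₗ = 0`. -/
def chiSquareSet (y : Fin I → ℝ) : Set (Fin L → ℝ) :=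
  {p | (∀ l, 0 ≤ p l) ∧ ∑ l, p l = 1 ∧ (∀ l, p l = 0 → D.phat y l = 0) ∧
    ∑ l, (p l - D.phat y l) ^ 2 / p l ≤ D.rho}

/-- Probability measures on `Ξₗ` for which all moment functions are integrable. -/
def momentMeasures (l : Fin L) : Set (Measure (Fin N → ℝ)) :=
  {P | IsProbabilityMeasure P ∧ P (D.Xi l)ᶜ = 0 ∧ ∀ m, Integrable (D.f m) P}

/-- The vector of moments `∫ f dP`. -/
def momentVector (P : Measure (Fin N → ℝ)) : Fin M → ℝ :=
  fun m => ∫ ξ, D.f m ξ ∂P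

/-- The moment-based ambiguity set `𝒰ₗ(y)`. -/
def ambiguitySet (l : Fin L) (y : Fin I → ℝ) : Set (Measure (Fin N → ℝ)) :=
  {P | P ∈ D.momentMeasures l ∧ ∀ m, D.momentVector P m ∈ Set.Icc (D.uLo y l m) (D.uHi y l m)}

/-- Relative interior points of the ambiguity set, in the sense of Slater's condition for its
moment description: the moment vector lies in the relative interior of the box of moment bounds
and in the relative interior of the convex set of all moment vectors attainable on `Ξₗ`. -/
def relInteriorAmbiguitySet (l : Fin L) (y : Fin I → ℝ) : Set (Measure (Fin N → ℝ)) :=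
  {P | P ∈ D.ambiguitySet l y ∧
    D.momentVector P ∈ intrinsicInterior ℝ (Set.Icc (D.uLo y l) (D.uHi y l)) ∧
    D.momentVector P ∈ intrinsicInterior ℝ (D.momentVector '' D.momentMeasures l)}

/-- The multimodal ambiguity set `Θ(y)` of all mixtures `∑ₗ pₗ ℙₗ`. -/
def multimodalSet (y : Fin I → ℝ) : Set (Measure (Fin N → ℝ)) :=
  {P | ∃ p ∈ D.chiSquareSet y, ∃ Pl : Fin L → Measure (Fin N → ℝ),
    (∀ l, Pl l ∈ D.ambiguitySet l y) ∧ P = ∑ l, ENNReal.ofReal (p l) • Pl l}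

/-- The expected second-stage costs attainable over `Θ(y)`. -/
def expectedCosts (y : Fin I → ℝ) : Set ℝ :=
  (fun P : Measure (Fin N → ℝ) => ∫ ξ, D.h y ξ ∂P) '' D.multimodalSet y

/-- Objective of the distributionally robust model, `cᵀ y + sup_{ℙ ∈ Θ(y)} 𝔼_ℙ[h(y, ξ)]`. -/
def modelObjective (y : Fin I → ℝ) : EReal :=
  ((D.c ⬝ᵥ y : ℝ) : EReal) + ⨆ v ∈ D.expectedCosts y, (v : EReal)

/-- `y` is an optimal solution of the distributionally robust model. -/
def IsModelOptimal (y : Fin I → ℝ) : Prop :=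
  y ∈ D.Y ∧ ∀ y' ∈ D.Y, D.modelObjective y ≤ D.modelObjective y'

/-- The decision variables of the conic reformulation other than `y`. -/
structure ConicVars (L M : ℕ) where
  lam : ℝ
  eta : ℝ
  psi : Fin L → ℝ
  r : Fin L → ℝ
  alpha : Fin L → ℝ
  betaLo : Fin L → Fin M → ℝ
  betaHi : Fin L → Fin M → ℝ

/-- Objective of the conic reformulation. -/
def conicObjective (y : Fin I → ℝ) (z : ConicVars L M) : ℝ :=
  D.c ⬝ᵥ y + z.eta + D.rho * z.lam + 2 * z.lam - 2 * ∑ l, D.phat y l * z.r l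

/-- Constraints of the semi-infinite second-order cone reformulation. -/
structure ConicFeasible (y : Fin I → ℝ) (z : ConicVars L M) : Prop where
  mem : y ∈ D.Y
  lam_nonneg : 0 ≤ z.lam
  betaLo_nonneg : ∀ l m, 0 ≤ z.betaLo l m
  betaHi_nonneg : ∀ l m, 0 ≤ z.betaHi l m
  moment : ∀ l, z.alpha l + z.betaHi l ⬝ᵥ D.uHi y l - z.betaLo l ⬝ᵥ D.uLo y l ≤ z.psi l
  cone : ∀ l, √((z.r l) ^ 2 + 1 / 4 * (z.psi l - z.eta) ^ 2) ≤
    z.lam - 1 / 2 * (z.psi l - z.eta)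
  slope : ∀ l, z.psi l - z.eta ≤ z.lam
  support : ∀ l, ∀ ξ ∈ D.Xi l,
    D.h y ξ ≤ z.alpha l + (z.betaHi l - z.betaLo l) ⬝ᵥ (fun m => D.f m ξ)

/-- `(y, z)` is an optimal solution of the conic reformulation. -/
def IsConicOptimal (y : Fin I → ℝ) (z : ConicVars L M) : Prop :=
  D.ConicFeasible y z ∧
    ∀ y' z', D.ConicFeasible y' z' → D.conicObjective y z ≤ D.conicObjective y' z'

end D3RO

end

/-! Fix `y`. The expected cost of a mixture is `p ⬝ᵥ (∫ h dℙₗ)ₗ`, and the weights are nonnegative,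
so the worst case splits: first the worst expectation `gₗ` of each mode, then the maximum of `p ⬝ᵥ
g` over the `χ²`-ball. Each maximization has its own convex dual. The variables `ψₗ ≥ gₗ` glue the
duals together, since `p ⬝ᵥ g ≤ p ⬝ᵥ ψ`.

For one mode, a dual solution is a majorant of `h` affine in the moment functions; integrating it
gives weak duality. Under the relative interior condition, `exists_supergradient` applied to the
perturbation set of the moment problem produces an optimal dual solution. For continuous moment
functions, the compact convex hull of the graph of `(f, h)` is strictly separated from the box times
a half-line, which gives dual solutions with arbitrarily small loss.

For the mode probabilities, the conjugate of one `χ²`-term is `sup_p (p s - λ (p - c)² / p) = 2 λ c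
- 2 c √(λ (λ - s))`. The variable `rₗ` replaces the square root, and `r² ≤ λ (λ - s)` is the
second-order cone constraint. If `ρ > 0`, then `p̂` is a Slater point and the dual is attained; if
`ρ = 0`, the value is approached by letting `λ` grow.

Integrability and finiteness rest on the continuity of `h y` on each compact `Ξₗ`. It follows from
linear programming duality and the stability of primal and dual feasible sets, both consequences of
bounded representations in finitely generated cones (`exists_bounded_conic_representation`). -/

/-! ### Convex analysis: supergradients, relative interiors, convex hulls -/

/-- A convex set of pairs `(w, t)` whose projection has `0` in its relative algebraic interior and
whose fibre over `0` is bounded above by `g` lies below an affine function with value `g` at `0`. -/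
theorem exists_supergradient {E : Type*} [AddCommGroup E] [Module ℝ E] {K : Set (E × ℝ)}
    (hK : Convex ℝ K) {g : ℝ} (hg : ∀ t, ((0 : E), t) ∈ K → t ≤ g)
    (hcore : ∀ p ∈ K, ∃ ε : ℝ, 0 < ε ∧ ∃ t, (-(ε • p.1), t) ∈ K) :
    ∃ φ : E →ₗ[ℝ] ℝ, ∀ p ∈ K, p.2 ≤ g + φ p.1 := by
  rcases K.eq_empty_or_nonempty with rfl | ⟨k₀, hk₀⟩
  · exact ⟨0, by simp⟩
  -- The cone over the points `(w, a)` with `a ≥ g - t` for some `(w, t) ∈ K`, together with the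
  -- upward vertical ray. A linear functional that is nonnegative on it and equal to `a` on the
  -- vertical axis is the desired affine bound.
  let C : PointedCone ℝ (E × ℝ) :=
    { carrier := {p | ∃ r : ℝ, 0 ≤ r ∧ ∃ k ∈ K, p.1 = r • k.1 ∧ r * (g - k.2) ≤ p.2}
      zero_mem' := ⟨0, le_rfl, k₀, hk₀, by simp, by simp⟩
      add_mem' := by
        rintro p q ⟨r, hr, k, hk, hp, hp'⟩ ⟨s, hs, m, hm, hq, hq'⟩
        rcases hr.eq_or_lt with rfl | hr'
        · exact ⟨s, hs, m, hm, by simp [hp, hq], by simp at hp' ⊢; linarith⟩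
        · have hrs : 0 < r + s := by positivity
          refine ⟨r + s, hrs.le, (r / (r + s)) • k + (s / (r + s)) • m,
            hK hk hm (by positivity) (by positivity) (by field_simp), ?_, ?_⟩
          · simp only [Prod.fst_add, Prod.smul_fst, smul_add, smul_smul, hp, hq]
            rw [mul_div_cancel₀ _ hrs.ne', mul_div_cancel₀ _ hrs.ne']
          · have : (r + s) * (g - ((r / (r + s)) • k + (s / (r + s)) • m).2) =
                r * (g - k.2) + s * (g - m.2) := by
              simp only [Prod.snd_add, Prod.smul_snd, smul_eq_mul]
              field_simp
              ring
            rw [this, Prod.snd_add]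
            linarith
      smul_mem' := by
        rintro ⟨a, ha⟩ p ⟨r, hr, k, hk, hp, hp'⟩
        refine ⟨a * r, mul_nonneg ha hr, k, hk, ?_, ?_⟩
        · simp [Nonneg.mk_smul, hp, smul_smul]
        · simp only [Nonneg.mk_smul, Prod.smul_snd, smul_eq_mul]
          rw [mul_assoc]
          exact mul_le_mul_of_nonneg_left hp' ha }
  have hC : ∀ p : E × ℝ, p ∈ C ↔
      ∃ r : ℝ, 0 ≤ r ∧ ∃ k ∈ K, p.1 = r • k.1 ∧ r * (g - k.2) ≤ p.2 := fun _ => Iff.rfl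
  have hCK : ∀ k ∈ K, (k.1, g - k.2) ∈ C := fun k hk =>
    (hC _).2 ⟨1, zero_le_one, k, hk, by simp, by simp⟩
  have hsmul : ∀ (a : ℝ) (_ : 0 ≤ a) (p : E × ℝ), p ∈ C → a • p ∈ C := fun a ha p hp =>
    PointedCone.smul_mem C ha hp
  have hneg : ∀ w a, (w, a) ∈ C → ∃ a', (-w, a') ∈ C := by
    rintro w a ⟨r, hr, k, hk, hw, -⟩
    obtain ⟨ε, hε, t, ht⟩ := hcore k hk
    refine ⟨_, (hC _).2 ⟨r / ε, by positivity, _, ht, ?_, le_rfl⟩⟩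
    simp only at hw
    rw [hw, smul_neg, smul_smul, div_mul_cancel₀ _ hε.ne']
  -- The projection of `C` is closed under negation by `hcore`, hence a subspace. The density
  -- condition of the Riesz extension theorem holds over `V`, because each of its points lifts to
  -- `C` by a vertical shift.
  let V : Submodule ℝ E :=
    { carrier := {w | ∃ a, (w, a) ∈ C}
      zero_mem' := ⟨0, C.zero_mem⟩
      add_mem' := by
        rintro w w' ⟨a, ha⟩ ⟨a', ha'⟩
        exact ⟨a + a', C.add_mem ha ha'⟩
      smul_mem' := by
        rintro r w ⟨a, ha⟩
        rcases le_total 0 r with hr | hr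
        · exact ⟨r * a, hsmul r hr _ ha⟩
        · obtain ⟨a', ha'⟩ := hneg w a ha
          have := hsmul (-r) (by linarith) _ ha'
          exact ⟨-r * a', by simpa using this⟩ }
  let S : PointedCone ℝ (V × ℝ) :=
    PointedCone.comap (LinearMap.prodMap V.subtype (LinearMap.id : ℝ →ₗ[ℝ] ℝ)) C
  have hS : ∀ p : V × ℝ, p ∈ S ↔ ((p.1 : E), p.2) ∈ C := fun _ => Iff.rfl
  let F : V × ℝ →ₗ.[ℝ] ℝ :=
    { domain := LinearMap.ker (LinearMap.fst ℝ V ℝ)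
      toFun := (LinearMap.snd ℝ V ℝ).comp (Submodule.subtype _) }
  have hnonneg : ∀ x : F.domain, (x : V × ℝ) ∈ S → 0 ≤ F x := by
    rintro ⟨⟨w, a⟩, hx⟩ hxS
    have hw : w = 0 := by simpa [F] using! hx
    subst hw
    obtain ⟨r, hr, k, hk, h1, h2⟩ := (hC _).1 ((hS _).1 hxS)
    change 0 ≤ a
    simp only [ZeroMemClass.coe_zero] at h1 h2
    rcases hr.eq_or_lt with rfl | hr'
    · simpa using h2
    · have hk1 : k.1 = 0 := (smul_eq_zero.1 h1.symm).resolve_left hr'.ne'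
      have := hg k.2 (by rw [← hk1]; exact hk)
      exact le_trans (mul_nonneg hr (by linarith)) h2
  have hdense : ∀ y : V × ℝ, ∃ x : F.domain, (x : V × ℝ) + y ∈ S := by
    rintro ⟨⟨w, a, ha⟩, b⟩
    refine ⟨⟨(0, a - b), by simp [F]⟩, ?_⟩
    rw [hS]
    simpa using ha
  obtain ⟨G, hG, hGS⟩ := riesz_extension S F hnonneg hdense
  obtain ⟨φ, hφ⟩ := LinearMap.exists_extend (p := V) (G.comp (LinearMap.inl ℝ V ℝ))
  refine ⟨φ, fun p hp => ?_⟩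
  have hpV : p.1 ∈ V := ⟨_, hCK p hp⟩
  have h1 := hGS (⟨p.1, hpV⟩, g - p.2) ((hS _).2 (hCK p hp))
  have h2 : φ p.1 = G (⟨p.1, hpV⟩, 0) := by
    have := LinearMap.congr_fun hφ ⟨p.1, hpV⟩
    simpa using this
  have h3 : G ((0 : V), g - p.2) = g - p.2 := hG ⟨(0, g - p.2), by simp [F]⟩
  have h4 : ((⟨p.1, hpV⟩ : V), g - p.2) = (⟨p.1, hpV⟩, 0) + (0, g - p.2) := by simp
  rw [h4, map_add, h3] at h1
  linarith

/-- A segment ending at a relative interior point can be prolonged within the set. -/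
theorem eventually_add_smul_sub_mem_of_mem_intrinsicInterior {E : Type*} [NormedAddCommGroup E]
    [NormedSpace ℝ E] {s : Set E} {x : E} (hx : x ∈ intrinsicInterior ℝ s) {c : E} (hc : c ∈ s) :
    ∀ᶠ ε : ℝ in nhds 0, x + ε • (x - c) ∈ s := by
  obtain ⟨⟨x, hx'⟩, hxi, rfl⟩ := hx
  have hc' : c ∈ affineSpan ℝ s := subset_affineSpan ℝ s hc
  have hmem : ∀ ε : ℝ, x + ε • (x - c) ∈ affineSpan ℝ s := fun ε => by
    have := AffineMap.lineMap_mem (1 + ε) hc' hx'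
    rw [AffineMap.lineMap_apply] at this
    convert! this using 1
    simp only [vsub_eq_sub, vadd_eq_add, add_smul, one_smul]
    abel
  -- The whole line lies in the affine span, where the relative interior is an ordinary interior.
  let γ : ℝ → affineSpan ℝ s := fun ε => ⟨x + ε • (x - c), hmem ε⟩
  have hγ : Continuous γ := by
    apply Continuous.subtype_mk
    fun_prop
  have h0 : γ 0 = ⟨x, hx'⟩ := by simp [γ]
  have := hγ.tendsto 0
  rw [h0] at this
  filter_upwards [this (mem_interior_iff_mem_nhds.1 hxi)] with ε hε using hε

/-- In finite dimension the convex hull of a compact set is compact. -/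
theorem IsCompact.convexHull_of_finiteDimensional {E : Type*} [NormedAddCommGroup E]
    [NormedSpace ℝ E] [FiniteDimensional ℝ E] {K : Set E} (hK : IsCompact K) :
    IsCompact (convexHull ℝ K) := by
  rcases K.eq_empty_or_nonempty with rfl | ⟨k₀, hk₀⟩
  · simp
  let d := Module.finrank ℝ E + 1
  have hcomp : IsCompact ((fun p : (Fin d → ℝ) × (Fin d → E) => ∑ i, p.1 i • p.2 i) ''
      (stdSimplex ℝ (Fin d) ×ˢ Set.univ.pi fun _ => K)) := by
    refine ((isCompact_stdSimplex ℝ (Fin d)).prod (isCompact_univ_pi fun _ => hK)).image ?_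
    fun_prop
  convert hcomp
  ext x
  constructor
  · intro hx
    obtain ⟨ι, _, z, w, hz, hind, hw, hw1, rfl⟩ := eq_pos_convex_span_of_mem_convexHull hx
    have hcard : Fintype.card ι ≤ d :=
      (hind.card_le_finrank_succ).trans (Nat.succ_le_succ (Submodule.finrank_le _))
    obtain ⟨e⟩ : Nonempty (ι ↪ Fin d) := by
      apply Function.Embedding.nonempty_of_card_le
      simpa using hcard
    classical
    -- Carathéodory may give fewer than `d` points; the remaining slots get weight zero and the
    -- dummy point `k₀`.
    let w' : Fin d → ℝ := fun j => if h : ∃ i, e i = j then w h.choose else 0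
    let z' : Fin d → E := fun j => if h : ∃ i, e i = j then z h.choose else k₀
    have hch : ∀ i, (⟨i, rfl⟩ : ∃ i', e i' = e i).choose = i := fun i =>
      e.injective (⟨i, rfl⟩ : ∃ i', e i' = e i).choose_spec
    have hw' : ∀ i, w' (e i) = w i := fun i => by
      simp only [w']; rw [dif_pos ⟨i, rfl⟩, hch]
    have hz' : ∀ i, z' (e i) = z i := fun i => by
      simp only [z']; rw [dif_pos ⟨i, rfl⟩, hch]
    have hout : ∀ j, j ∉ Set.range e → w' j = 0 := fun j hj => dif_neg fun ⟨i, hi⟩ => hj ⟨i, hi⟩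
    refine ⟨(w', z'), ⟨⟨fun j => ?_, ?_⟩, fun j _ => ?_⟩, ?_⟩
    · by_cases hj : j ∈ Set.range e
      · obtain ⟨i, rfl⟩ := hj
        exact (hw i).le.trans_eq (hw' i).symm
      · exact (hout j hj).ge
    · rw [← hw1]
      exact (Fintype.sum_of_injective e e.injective _ _ hout fun i => (hw' i).symm).symm
    · by_cases hj : j ∈ Set.range e
      · obtain ⟨i, rfl⟩ := hj
        exact (congrArg (· ∈ K) (hz' i)).mpr (hz ⟨i, rfl⟩)
      · simp only [z']; rw [dif_neg fun ⟨i, hi⟩ => hj ⟨i, hi⟩]; exact hk₀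
    · exact (Fintype.sum_of_injective e e.injective _ _ (fun j hj => by simp [hout j hj])
        fun i => by simp [hw', hz']).symm
  · rintro ⟨⟨w, z⟩, ⟨⟨hw, hw1⟩, hz⟩, rfl⟩
    exact (convex_convexHull ℝ K).sum_mem (fun i _ => hw i) hw1
      fun i _ => subset_convexHull ℝ K (hz i trivial)

/-! ### Finitely generated cones -/

section Conic

variable {α E : Type*} [Fintype α] [NormedAddCommGroup E] [NormedSpace ℝ E]

/-- Carathéodory's theorem for cones: a nonnegative vector can be moved within the fibre of a linear
map until the map is injective on the vectors with the same support. -/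
theorem exists_nonneg_map_eq_injOn_support (B : (α → ℝ) →ₗ[ℝ] E) (μ : α → ℝ) (hμ : 0 ≤ μ) :
    ∃ ν : α → ℝ, 0 ≤ ν ∧ B ν = B μ ∧ ∀ a : α → ℝ, (∀ i, ν i = 0 → a i = 0) → B a = 0 → a = 0 := by
  classical
  induction hn : (Finset.univ.filter fun i => μ i ≠ 0).card using Nat.strong_induction_on
    generalizing μ with
  | _ n ih =>
    by_cases hinj : ∀ a : α → ℝ, (∀ i, μ i = 0 → a i = 0) → B a = 0 → a = 0
    · exact ⟨μ, hμ, rfl, hinj⟩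
    push Not at hinj
    obtain ⟨a₀, ha₀, hB₀, hne₀⟩ := hinj
    obtain ⟨a, ha, hB, i₀, hi₀⟩ : ∃ a : α → ℝ, (∀ i, μ i = 0 → a i = 0) ∧ B a = 0 ∧
        ∃ i, 0 < a i := by
      obtain ⟨i, hi⟩ := Function.ne_iff.1 hne₀
      rcases lt_or_gt_of_ne hi with h | h
      · exact ⟨-a₀, fun j hj => by simp [ha₀ j hj], by simp [hB₀], i, by simpa using h⟩
      · exact ⟨a₀, ha₀, hB₀, i, h⟩
    obtain ⟨k, hk, hmin⟩ := Finset.exists_min_image (Finset.univ.filter fun i => 0 < a i)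
      (fun i => μ i / a i) ⟨i₀, by simpa using hi₀⟩
    simp only [Finset.mem_filter, Finset.mem_univ, true_and] at hk hmin
    -- The longest step along `-a` that keeps `μ` nonnegative; it annihilates coordinate `k` and so
    -- shrinks the support.
    let θ := μ k / a k
    have hθ : 0 ≤ θ := div_nonneg (hμ k) hk.le
    have hν : 0 ≤ μ - θ • a := fun i => by
      simp only [Pi.zero_apply, Pi.sub_apply, Pi.smul_apply, smul_eq_mul, sub_nonneg]
      rcases le_or_gt (a i) 0 with h | h
      · exact (mul_nonpos_of_nonneg_of_nonpos hθ h).trans (hμ i)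
      · exact (le_div_iff₀ h).1 (hmin i h)
    have hcard : (Finset.univ.filter fun i => (μ - θ • a) i ≠ 0).card < n := by
      rw [← hn]
      apply Finset.card_lt_card
      rw [Finset.ssubset_iff_of_subset]
      · refine ⟨k, ?_, ?_⟩
        · simp only [Finset.mem_filter, Finset.mem_univ, true_and]
          exact fun h => hk.ne' (ha k h)
        · simp [θ, hk.ne']
      · intro i
        simp only [Finset.mem_filter, Finset.mem_univ, true_and]
        intro h h0
        exact h (by simp [h0, ha i h0])
    obtain ⟨ν, h1, h2, h3⟩ := ih _ hcard _ hν rfl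
    exact ⟨ν, h1, by rw [h2, map_sub, map_smul, hB]; simp, h3⟩

/-- Points of a finitely generated cone have nonnegative coefficients bounded by a multiple of their
norm. -/
theorem exists_bounded_conic_representation (B : (α → ℝ) →ₗ[ℝ] E) :
    ∃ κ : ℝ, 0 ≤ κ ∧ ∀ μ : α → ℝ, 0 ≤ μ →
      ∃ ν : α → ℝ, 0 ≤ ν ∧ B ν = B μ ∧ ∀ i, ν i ≤ κ * ‖B μ‖ := by
  classical
  -- On each support where `B` is injective it is bounded below. There are finitely many supports,
  -- so the sum of their constants serves all of them.
  have key : ∀ s : Set α, ∃ κ : ℝ, 0 ≤ κ ∧ ((∀ a : α → ℝ, (∀ i ∉ s, a i = 0) → B a = 0 → a = 0) →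
      ∀ a : α → ℝ, (∀ i ∉ s, a i = 0) → ‖a‖ ≤ κ * ‖B a‖) := by
    intro s
    by_cases h : ∀ a : α → ℝ, (∀ i ∉ s, a i = 0) → B a = 0 → a = 0
    · let V : Submodule ℝ (α → ℝ) :=
        { carrier := {a | ∀ i ∉ s, a i = 0}
          zero_mem' := by simp
          add_mem' := fun {a b} ha hb i hi => by simp [ha i hi, hb i hi]
          smul_mem' := fun r a ha i hi => by simp [ha i hi] }
      obtain ⟨κ, -, hκ⟩ := LinearMap.exists_antilipschitzWith (B.comp V.subtype) (by
        rw [LinearMap.ker_eq_bot']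
        rintro ⟨a, ha⟩ h0
        exact Subtype.ext (h a ha h0))
      refine ⟨κ, κ.2, fun _ a ha => ?_⟩
      have := hκ.le_mul_norm (map_zero _) (⟨a, ha⟩ : V)
      simpa using! this
    · exact ⟨0, le_rfl, fun h' => absurd h' h⟩
  choose κ hκ0 hκ using key
  refine ⟨∑ s, κ s, Finset.sum_nonneg fun s _ => hκ0 s, fun μ hμ => ?_⟩
  obtain ⟨ν, hν, hB, hinj⟩ := exists_nonneg_map_eq_injOn_support B μ hμ
  refine ⟨ν, hν, hB, fun i => ?_⟩
  have h1 := hκ {i | ν i ≠ 0} (fun a ha => hinj a fun i hi => ha i (by simpa using hi)) ν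
    (fun i hi => by simpa using hi)
  calc ν i ≤ ‖ν i‖ := Real.le_norm_self _
    _ ≤ ‖ν‖ := norm_le_pi_norm ν i
    _ ≤ _ := h1
    _ ≤ (∑ s, κ s) * ‖B ν‖ := by
      gcongr
      exact Finset.single_le_sum (f := κ) (fun s _ => hκ0 s) (Finset.mem_univ _)
    _ = _ := by rw [hB]

/-- Finitely generated cones are closed. -/
theorem isClosed_image_nonneg (B : (α → ℝ) →ₗ[ℝ] E) : IsClosed (B '' {μ | 0 ≤ μ}) := by
  obtain ⟨κ, hκ0, hκ⟩ := exists_bounded_conic_representation B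
  refine isClosed_of_closure_subset fun x hx => ?_
  have hcomp : IsCompact (B '' Set.Icc 0 fun _ => κ * (‖x‖ + 1)) :=
    isCompact_Icc.image B.continuous_of_finiteDimensional
  have h1 : x ∈ closure (Metric.ball x 1 ∩ B '' {μ | 0 ≤ μ}) :=
    Metric.isOpen_ball.inter_closure ⟨Metric.mem_ball_self one_pos, hx⟩
  have h2 : Metric.ball x 1 ∩ B '' {μ | 0 ≤ μ} ⊆ B '' Set.Icc 0 fun _ => κ * (‖x‖ + 1) := by
    rintro _ ⟨hb, μ, hμ, rfl⟩
    obtain ⟨ν, hν, hB, hle⟩ := hκ μ hμ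
    refine ⟨ν, ⟨hν, fun i => (hle i).trans (mul_le_mul_of_nonneg_left ?_ hκ0)⟩, hB⟩
    have := norm_sub_norm_le (B μ) x
    rw [Metric.mem_ball, dist_eq_norm] at hb
    linarith
  obtain ⟨ν, hν, hB⟩ := closure_minimal h2 hcomp.isClosed h1
  exact ⟨ν, hν.1, hB⟩

end Conic

/-! ### Linear programming: duality and continuity of the value -/

section LinearProgramming

variable {m n : Type*} [Fintype m] [Fintype n]

/-- Strong duality of linear programming: a lower bound of a feasible program is certified by a dual
solution. -/
theorem exists_dual_solution (W : Matrix m n ℝ) (b : m → ℝ) (c : n → ℝ) {v : ℝ}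
    (hne : ∃ x, b ≤ W *ᵥ x) (hv : ∀ x, b ≤ W *ᵥ x → v ≤ c ⬝ᵥ x) :
    ∃ π : m → ℝ, 0 ≤ π ∧ Wᵀ *ᵥ π = c ∧ v ≤ b ⬝ᵥ π := by
  classical
  -- The extra coordinate is a slack for `v ≤ b ⬝ᵥ π`. A dual solution exists exactly when `(c, v)`
  -- lies in the closed cone `B '' {μ | 0 ≤ μ}`; otherwise a separating functional yields a primal
  -- contradiction.
  let B : (m ⊕ Unit → ℝ) →ₗ[ℝ] (n → ℝ) × ℝ :=
    { toFun := fun μ => (Wᵀ *ᵥ (μ ∘ Sum.inl), b ⬝ᵥ (μ ∘ Sum.inl) - μ (Sum.inr ()))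
      map_add' := fun μ ν => by
        have : (μ + ν) ∘ Sum.inl = μ ∘ Sum.inl + ν ∘ (Sum.inl : m → m ⊕ Unit) := rfl
        simp only [this, Matrix.mulVec_add, dotProduct_add, Pi.add_apply, Prod.mk_add_mk]
        congr 1
        ring
      map_smul' := fun r μ => by
        have : (r • μ) ∘ Sum.inl = r • (μ ∘ (Sum.inl : m → m ⊕ Unit)) := rfl
        simp only [this, Matrix.mulVec_smul, dotProduct_smul, Pi.smul_apply, smul_eq_mul,
          RingHom.id_apply, Prod.smul_mk]
        congr 1
        ring }
  by_cases hmem : (c, v) ∈ B '' {μ | 0 ≤ μ}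
  · obtain ⟨μ, hμ, hB⟩ := hmem
    have h1 : Wᵀ *ᵥ (μ ∘ Sum.inl) = c := congrArg Prod.fst hB
    have h2 : b ⬝ᵥ (μ ∘ Sum.inl) - μ (Sum.inr ()) = v := congrArg Prod.snd hB
    have h3 : 0 ≤ μ (Sum.inr ()) := hμ _
    exact ⟨μ ∘ Sum.inl, fun i => hμ _, h1, by linarith⟩
  exfalso
  have hconv : Convex ℝ (B '' {μ | 0 ≤ μ}) := (convex_Ici (0 : m ⊕ Unit → ℝ)).linear_image B
  obtain ⟨F, u, hFu, hF⟩ :=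
    geometric_hahn_banach_point_closed hconv (isClosed_image_nonneg B) hmem
  have hu : u < 0 := by simpa using hF 0 ⟨0, le_refl (0 : m ⊕ Unit → ℝ), map_zero B⟩
  have hFnonneg : ∀ μ : m ⊕ Unit → ℝ, 0 ≤ μ → 0 ≤ F (B μ) := by
    intro μ hμ
    by_contra hlt
    push Not at hlt
    have := hF (B ((u / F (B μ)) • μ))
      ⟨_, smul_nonneg (div_nonneg_of_nonpos hu.le hlt.le) hμ, rfl⟩
    rw [map_smul, map_smul, smul_eq_mul, div_mul_cancel₀ _ hlt.ne] at this
    exact this.false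
  let x : n → ℝ := fun j => F (Pi.single j 1, 0)
  let θ : ℝ := -F (0, 1)
  have hFx : ∀ (p : n → ℝ) (τ : ℝ), F (p, τ) = x ⬝ᵥ p - θ * τ := by
    intro p τ
    have h1 : (p, τ) = LinearMap.inl ℝ (n → ℝ) ℝ p + τ • ((0 : n → ℝ), (1 : ℝ)) := by simp
    have h2 : F (LinearMap.inl ℝ (n → ℝ) ℝ p) = x ⬝ᵥ p := by
      have := LinearMap.pi_apply_eq_sum_univ (F.toLinearMap.comp (LinearMap.inl ℝ (n → ℝ) ℝ)) p
      simp only [LinearMap.comp_apply, ContinuousLinearMap.coe_coe] at this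
      rw [this]
      simp only [dotProduct, x, smul_eq_mul]
      refine Finset.sum_congr rfl fun j _ => ?_
      rw [mul_comm]
      congr 2
      simp only [LinearMap.inl_apply, Prod.mk.injEq, and_true]
      ext i
      simp [Pi.single_apply, eq_comm]
    rw [h1, map_add, map_smul, h2]
    simp only [smul_eq_mul, θ]
    ring
  have hθ : 0 ≤ θ := by
    have := hFnonneg (Sum.elim 0 1) (by rintro (i | i) <;> simp)
    simpa [B, hFx] using! this
  have hWx : ∀ i, θ * b i ≤ (W *ᵥ x) i := by
    intro i
    have := hFnonneg (Sum.elim (Pi.single i 1) 0) (by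
      rintro (j | j)
      · exact (Pi.single_nonneg.2 zero_le_one : (0 : m → ℝ) ≤ Pi.single i 1) j
      · simp)
    simp only [B, LinearMap.coe_mk, AddHom.coe_mk, Sum.elim_comp_inl, Sum.elim_inr, Pi.zero_apply,
      hFx, Matrix.mulVec_single_one, dotProduct_single_one, sub_zero] at this
    have h : (W *ᵥ x) i = x ⬝ᵥ Wᵀ.col i := by
      rw [dotProduct_comm]; rfl
    rw [h]
    linarith
  have hcx : x ⬝ᵥ c - θ * v < 0 := by
    rw [← hFx]
    exact hFu.trans hu
  -- If `θ = 0`, then `x` is a recession direction of negative cost and the program is unbounded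
  -- below. If `θ > 0`, then `θ⁻¹ • x` is feasible with cost below `v`.
  rcases hθ.eq_or_lt with h0 | hpos
  · obtain ⟨x₀, hx₀⟩ := hne
    simp only [← h0, zero_mul, sub_zero] at hcx hWx
    have hray : ∀ r : ℝ, 0 ≤ r → v ≤ c ⬝ᵥ (x₀ + r • x) := fun r hr => by
      apply hv
      rw [Matrix.mulVec_add, Matrix.mulVec_smul]
      intro i
      have := mul_nonneg hr (hWx i)
      simp only [Pi.add_apply, Pi.smul_apply, smul_eq_mul]
      linarith [hx₀ i]
    have h1 := hv x₀ hx₀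
    -- The length of the ray is chosen so that the cost reaches `v - 1`.
    have h2 := hray ((c ⬝ᵥ x₀ - v + 1) / (-(x ⬝ᵥ c)))
      (div_nonneg (by linarith) (by linarith))
    rw [dotProduct_add, dotProduct_smul, smul_eq_mul, dotProduct_comm c x, div_mul_eq_mul_div,
      mul_div_assoc, div_neg, div_self hcx.ne] at h2
    linarith
  · have h1 := hv (θ⁻¹ • x) (fun i => by
      rw [Matrix.mulVec_smul, Pi.smul_apply, smul_eq_mul, ← div_eq_inv_mul, le_div_iff₀ hpos]
      linarith [hWx i])
    rw [dotProduct_smul, smul_eq_mul, ← div_eq_inv_mul, le_div_iff₀ hpos, dotProduct_comm] at h1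
    linarith

/-- Inner semicontinuity of the feasible set of a linear program in its right-hand side, along
right-hand sides for which the program is feasible. -/
theorem exists_feasible_near (A : Matrix m n ℝ) {b₀ : m → ℝ} {x₀ : n → ℝ} (h₀ : b₀ ≤ A *ᵥ x₀)
    {ε : ℝ} (hε : 0 < ε) :
    ∃ δ : ℝ, 0 < δ ∧ ∀ b : m → ℝ, (∃ x, b ≤ A *ᵥ x) → ‖b - b₀‖ < δ →
      ∃ x, b ≤ A *ᵥ x ∧ ‖x - x₀‖ < ε := by
  classical
  -- The coordinates are the positive and negative parts of a vector, a slack, and a multiple `σ` of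
  -- `b₀`. A feasible `x` for `b` gives a preimage of `b - b₀` with `σ = 1`; a bounded preimage then
  -- gives a small correction `y` and a small `σ`, and `(1 - σ) • x₀ + y` is feasible for `b`.
  let B : ((n ⊕ n) ⊕ (m ⊕ Unit) → ℝ) →ₗ[ℝ] (m → ℝ) :=
    { toFun := fun μ => A *ᵥ (fun j => μ (Sum.inl (Sum.inl j)) - μ (Sum.inl (Sum.inr j))) -
        (fun i => μ (Sum.inr (Sum.inl i))) - μ (Sum.inr (Sum.inr ())) • b₀
      map_add' := fun μ ν => by
        have : (fun j => (μ + ν) (Sum.inl (Sum.inl j)) - (μ + ν) (Sum.inl (Sum.inr j))) =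
          (fun j => μ (Sum.inl (Sum.inl j)) - μ (Sum.inl (Sum.inr j))) +
          fun j : n => ν (Sum.inl (Sum.inl j)) - ν (Sum.inl (Sum.inr j)) := by
          ext j; simp; ring
        rw [this, Matrix.mulVec_add]
        ext i
        simp
        ring
      map_smul' := fun r μ => by
        have : (fun j => (r • μ) (Sum.inl (Sum.inl j)) - (r • μ) (Sum.inl (Sum.inr j))) =
          r • (fun j : n => μ (Sum.inl (Sum.inl j)) - μ (Sum.inl (Sum.inr j))) := by
          ext j; simp; ring
        rw [this, Matrix.mulVec_smul]
        ext i
        simp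
        ring }
  obtain ⟨κ, hκ0, hκ⟩ := exists_bounded_conic_representation B
  let M := κ * (‖x₀‖ + 1)
  have hM : 0 ≤ M := by positivity
  refine ⟨min ((κ + 1)⁻¹) (ε / (M + 1)), by positivity, fun b ⟨x, hx⟩ hb => ?_⟩
  have hb1 : ‖b - b₀‖ < (κ + 1)⁻¹ := hb.trans_le (min_le_left _ _)
  have hb2 : ‖b - b₀‖ < ε / (M + 1) := hb.trans_le (min_le_right _ _)
  let μ : (n ⊕ n) ⊕ (m ⊕ Unit) → ℝ :=
    Sum.elim (Sum.elim (fun j => max (x j) 0) (fun j => max (-x j) 0))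
      (Sum.elim (fun i => (A *ᵥ x) i - b i) 1)
  have hμ : 0 ≤ μ := by
    rintro ((j | j) | (i | i)) <;> simp [μ]
    exact hx i
  have hBμ : B μ = b - b₀ := by
    have : (fun j => max (x j) 0 - max (-x j) 0) = x := by
      ext j
      rcases le_total 0 (x j) with h | h <;> simp [h]
    simp only [B, μ, LinearMap.coe_mk, AddHom.coe_mk, Sum.elim_inl, Sum.elim_inr, this]
    ext i
    simp
  obtain ⟨ν, hν, hBν, hle⟩ := hκ μ hμ
  rw [hBμ] at hBν hle
  let y : n → ℝ := fun j => ν (Sum.inl (Sum.inl j)) - ν (Sum.inl (Sum.inr j))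
  let σ := ν (Sum.inr (Sum.inr ()))
  have hσ0 : 0 ≤ σ := hν _
  have hσle : σ ≤ κ * ‖b - b₀‖ := hle _
  have hσ1 : σ ≤ 1 := by
    refine hσle.trans ?_
    calc κ * ‖b - b₀‖ ≤ κ * (κ + 1)⁻¹ := by gcongr
      _ ≤ 1 := by rw [← div_eq_mul_inv, div_le_one (by positivity)]; linarith
  have hy : ‖y‖ ≤ κ * ‖b - b₀‖ := by
    rw [pi_norm_le_iff_of_nonneg (by positivity)]
    intro j
    rw [Real.norm_eq_abs, abs_le]
    have h1 := hle (Sum.inl (Sum.inl j))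
    have h2 := hle (Sum.inl (Sum.inr j))
    have h3 : 0 ≤ ν (Sum.inl (Sum.inl j)) := hν _
    have h4 : 0 ≤ ν (Sum.inl (Sum.inr j)) := hν _
    constructor <;> simp only [y] <;> linarith
  refine ⟨(1 - σ) • x₀ + y, fun i => ?_, ?_⟩
  · have h1 := congrFun hBν i
    simp only [B, LinearMap.coe_mk, AddHom.coe_mk, Pi.sub_apply, Pi.smul_apply, smul_eq_mul] at h1
    have h2 : 0 ≤ ν (Sum.inr (Sum.inl i)) := hν _
    have h3 := mul_le_mul_of_nonneg_left (h₀ i) (sub_nonneg.2 hσ1)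
    rw [Matrix.mulVec_add, Matrix.mulVec_smul]
    simp only [Pi.add_apply, Pi.smul_apply, smul_eq_mul]
    change (A *ᵥ y) i - _ - σ * b₀ i = _ at h1
    linarith
  · have h1 : (1 - σ) • x₀ + y - x₀ = y - σ • x₀ := by
      rw [sub_smul, one_smul]; abel
    rw [h1]
    calc ‖y - σ • x₀‖ ≤ ‖y‖ + ‖σ • x₀‖ := norm_sub_le _ _
      _ = ‖y‖ + σ * ‖x₀‖ := by rw [norm_smul, Real.norm_of_nonneg hσ0]
      _ ≤ κ * ‖b - b₀‖ + κ * ‖b - b₀‖ * ‖x₀‖ := by gcongr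
      _ = M * ‖b - b₀‖ := by simp only [M]; ring
      _ ≤ (M + 1) * ‖b - b₀‖ := by gcongr; linarith
      _ < ε := by rwa [lt_div_iff₀ (by positivity), mul_comm] at hb2

/-- The optimal value of a linear program whose cost and right-hand side depend continuously on a
parameter is continuous along the parameters for which it is feasible and bounded. -/
theorem continuousOn_linearProgram_value {X : Type*} [TopologicalSpace X] {s : Set X}
    (W : Matrix m n ℝ) {b : X → m → ℝ} {c : X → n → ℝ} (hb : ContinuousOn b s)
    (hc : ContinuousOn c s) (hne : ∀ ξ ∈ s, {x | b ξ ≤ W *ᵥ x}.Nonempty)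
    (hbdd : ∀ ξ ∈ s, BddBelow ((fun x => c ξ ⬝ᵥ x) '' {x | b ξ ≤ W *ᵥ x})) :
    ContinuousOn (fun ξ => sInf ((fun x => c ξ ⬝ᵥ x) '' {x | b ξ ≤ W *ᵥ x})) s := by
  classical
  intro ξ₀ hξ₀
  have hlb : ∀ ξ ∈ s, ∀ x, b ξ ≤ W *ᵥ x →
      sInf ((fun x => c ξ ⬝ᵥ x) '' {x | b ξ ≤ W *ᵥ x}) ≤ c ξ ⬝ᵥ x := fun ξ hξ x hx =>
    csInf_le (hbdd ξ hξ) ⟨x, hx, rfl⟩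
  refine tendsto_order.2 ⟨fun a ha => ?_, fun a ha => ?_⟩
  -- Lower semicontinuity: an optimal dual solution at `ξ₀` has dual feasible neighbours at nearby
  -- `ξ`, and weak duality applies.
  · obtain ⟨π₀, hπ₀, hWπ₀, hle⟩ :=
      exists_dual_solution W (b ξ₀) (c ξ₀) (hne ξ₀ hξ₀) (hlb ξ₀ hξ₀)
    let A : Matrix (m ⊕ (n ⊕ n)) m ℝ := Matrix.fromRows 1 (Matrix.fromRows Wᵀ (-Wᵀ))
    let d : X → m ⊕ (n ⊕ n) → ℝ := fun ξ => Sum.elim 0 (Sum.elim (c ξ) (-c ξ))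
    have hA : ∀ ξ π, d ξ ≤ A *ᵥ π ↔ 0 ≤ π ∧ Wᵀ *ᵥ π = c ξ := by
      intro ξ π
      simp only [A, d, Matrix.fromRows_mulVec, Matrix.one_mulVec, Matrix.neg_mulVec,
        Sum.elim_le_elim_iff, neg_le_neg_iff]
      exact and_congr_right fun _ => ⟨fun h => le_antisymm h.2 h.1, fun h => ⟨h.ge, h.le⟩⟩
    have hd : ContinuousOn d s := by
      refine continuousOn_pi.2 ?_
      rintro (i | (j | j))
      · exact continuousOn_const
      · exact continuousOn_pi.1 hc j
      · exact (continuousOn_pi.1 hc j).neg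
    have hcont : Continuous fun p : (m → ℝ) × (m → ℝ) => p.1 ⬝ᵥ p.2 := by fun_prop
    have hopen := (hcont.tendsto (b ξ₀, π₀)).eventually (lt_mem_nhds (ha.trans_le hle))
    obtain ⟨ε, hε, hball⟩ := Metric.eventually_nhds_iff.1 hopen
    obtain ⟨δ, hδ, hnear⟩ := exists_feasible_near A ((hA ξ₀ π₀).2 ⟨hπ₀, hWπ₀⟩) hε
    have e1 := (hb ξ₀ hξ₀).eventually (Metric.ball_mem_nhds (b ξ₀) hε)
    have e2 := (hd ξ₀ hξ₀).eventually (Metric.ball_mem_nhds (d ξ₀) hδ)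
    filter_upwards [e1, e2, self_mem_nhdsWithin] with ξ h1 h2 hξ
    obtain ⟨π₁, hπ₁, hW₁, -⟩ := exists_dual_solution W (b ξ) (c ξ) (hne ξ hξ) (hlb ξ hξ)
    obtain ⟨π, hπ, hlt⟩ := hnear (d ξ) ⟨π₁, (hA ξ π₁).2 ⟨hπ₁, hW₁⟩⟩ (by
      rwa [← dist_eq_norm])
    obtain ⟨hπ0, hWπ⟩ := (hA ξ π).1 hπ
    have h3 : a < b ξ ⬝ᵥ π := hball (y := (b ξ, π)) (by
      rw [Prod.dist_eq, max_lt_iff]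
      exact ⟨h1, by rwa [dist_eq_norm]⟩)
    refine h3.trans_le (le_csInf ((hne ξ hξ).image _) ?_)
    rintro _ ⟨x, hx, rfl⟩
    calc b ξ ⬝ᵥ π ≤ (W *ᵥ x) ⬝ᵥ π := dotProduct_le_dotProduct_of_nonneg_right hx hπ0
      _ = c ξ ⬝ᵥ x := by
        rw [← hWπ, Matrix.mulVec_transpose, ← Matrix.dotProduct_mulVec, dotProduct_comm]
  -- Upper semicontinuity: a nearly optimal primal solution at `ξ₀` has primal feasible neighbours.
  · obtain ⟨_, ⟨x₀, hx₀, rfl⟩, hlt⟩ := exists_lt_of_csInf_lt ((hne ξ₀ hξ₀).image _) ha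
    have hcont : Continuous fun p : (n → ℝ) × (n → ℝ) => p.1 ⬝ᵥ p.2 := by fun_prop
    have hopen := (hcont.tendsto (c ξ₀, x₀)).eventually (gt_mem_nhds hlt)
    obtain ⟨ε, hε, hball⟩ := Metric.eventually_nhds_iff.1 hopen
    obtain ⟨δ, hδ, hnear⟩ := exists_feasible_near W hx₀ hε
    have e1 := (hc ξ₀ hξ₀).eventually (Metric.ball_mem_nhds (c ξ₀) hε)
    have e2 := (hb ξ₀ hξ₀).eventually (Metric.ball_mem_nhds (b ξ₀) hδ)
    filter_upwards [e1, e2, self_mem_nhdsWithin] with ξ h1 h2 hξ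
    obtain ⟨x, hx, hlt⟩ := hnear (b ξ) (hne ξ hξ) (by
      rwa [← dist_eq_norm])
    refine (hlb ξ hξ x hx).trans_lt (hball (y := (c ξ, x)) ?_)
    rw [Prod.dist_eq, max_lt_iff]
    exact ⟨h1, by rwa [dist_eq_norm]⟩

end LinearProgramming

/-! ### Linear optimization over a `χ²`-ball -/

section ChiSquare

variable {ι : Type*} [Fintype ι]

/-- Probability vectors at `χ²`-distance at most `ρ` from `c`. -/
def chiSquareBall (c : ι → ℝ) (ρ : ℝ) : Set (ι → ℝ) :=
  {p | (∀ l, 0 ≤ p l) ∧ ∑ l, p l = 1 ∧ (∀ l, p l = 0 → c l = 0) ∧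
    ∑ l, (p l - c l) ^ 2 / p l ≤ ρ}

theorem self_mem_chiSquareBall {c : ι → ℝ} (hc : ∀ l, 0 ≤ c l) (hc1 : ∑ l, c l = 1) {ρ : ℝ}
    (hρ : 0 ≤ ρ) : c ∈ chiSquareBall c ρ :=
  ⟨hc, hc1, fun _ h => h, by simpa using hρ⟩

/-- `(lam, eta, r)` is feasible for the conic dual of `max {p ⬝ᵥ g | p ∈ chiSquareBall c ρ}`, with the
rotated cone constraint written without square roots. -/
structure ChiSquareDualFeasible (g : ι → ℝ) (lam eta : ℝ) (r : ι → ℝ) : Prop where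
  lam_nonneg : 0 ≤ lam
  slope : ∀ l, g l - eta ≤ lam
  sq_le : ∀ l, r l ^ 2 ≤ lam * (lam - (g l - eta))

/-- The term `s² / 4` cancels on squaring, and `l - s / 2` is nonnegative as the mean of `l` and `l
- s`. -/
theorem sqrt_add_le_iff_sq_le {r s l : ℝ} (hl : 0 ≤ l) (hs : s ≤ l) :
    √(r ^ 2 + 1 / 4 * s ^ 2) ≤ l - 1 / 2 * s ↔ r ^ 2 ≤ l * (l - s) := by
  rw [Real.sqrt_le_left (by linarith)]
  constructor <;> intro h <;> nlinarith

/-- Fenchel's inequality for one `χ²`-term. Multiplied by `p` and with `r` replaced by its bound `√l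
√(l - s)`, the gap is the square `(√(l - s) p - √l c)²`. -/
theorem mul_le_chiSquare_term {p c s l r : ℝ} (hp : 0 ≤ p) (hc : 0 ≤ c) (hpc : p = 0 → c = 0)
    (hl : 0 ≤ l) (hs : s ≤ l) (hr : r ^ 2 ≤ l * (l - s)) :
    p * s ≤ l * ((p - c) ^ 2 / p) + 2 * l * c - 2 * (c * r) := by
  rcases hp.eq_or_lt with rfl | hp'
  · simp [hpc rfl]
  have h1 : r ≤ √l * √(l - s) := by
    rw [← Real.sqrt_mul hl]
    exact Real.le_sqrt_of_sq_le hr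
  have h2 : √l ^ 2 = l := Real.sq_sqrt hl
  have h3 : √(l - s) ^ 2 = l - s := Real.sq_sqrt (by linarith)
  have h4 := sq_nonneg (√(l - s) * p - √l * c)
  have h5 : c * r * p ≤ c * (√l * √(l - s)) * p := by gcongr
  have h6 : l * (p - c) ^ 2 + (2 * l * c - 2 * (c * r) - p * s) * p =
      √(l - s) ^ 2 * p ^ 2 - 2 * (c * r * p) + √l ^ 2 * c ^ 2 := by
    rw [h2, h3]; ring
  have h7 : 0 ≤ (l * (p - c) ^ 2 + (2 * l * c - 2 * (c * r) - p * s) * p) / p := by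
    apply div_nonneg _ hp
    rw [h6]
    nlinarith
  rw [add_div, mul_div_assoc, mul_div_cancel_right₀ _ hp'.ne'] at h7
  linarith

/-- Weak duality for linear optimization over a `χ²`-ball. -/
theorem ChiSquareDualFeasible.dotProduct_le {c g : ι → ℝ} {ρ lam eta : ℝ} {r p : ι → ℝ}
    (h : ChiSquareDualFeasible g lam eta r) (hc : ∀ l, 0 ≤ c l) (hc1 : ∑ l, c l = 1)
    (hp : p ∈ chiSquareBall c ρ) :
    p ⬝ᵥ g ≤ eta + ρ * lam + 2 * lam - 2 * ∑ l, c l * r l := by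
  obtain ⟨hp0, hp1, hpc, hχ⟩ := hp
  have h1 : ∑ l, p l * (g l - eta) ≤
      ∑ l, (lam * ((p l - c l) ^ 2 / p l) + 2 * lam * c l - 2 * (c l * r l)) :=
    Finset.sum_le_sum fun l _ => mul_le_chiSquare_term (hp0 l) (hc l) (hpc l) h.lam_nonneg
      (h.slope l) (h.sq_le l)
  simp only [mul_sub, Finset.sum_sub_distrib, Finset.sum_add_distrib, ← Finset.mul_sum,
    ← Finset.sum_mul, hp1, hc1] at h1
  have h2 := mul_le_mul_of_nonneg_left hχ h.lam_nonneg
  simp only [dotProduct]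
  linarith

/-- For `c ≠ 0` both denominators are positive and the gap is the explicit nonnegative fraction in
`key`; for `c = 0` the term is linear. -/
theorem chiSquare_term_convex {p q c a b : ℝ} (hp : 0 ≤ p) (hq : 0 ≤ q) (hpc : p = 0 → c = 0)
    (hqc : q = 0 → c = 0) (ha : 0 ≤ a) (hb : 0 ≤ b) (hab : a + b = 1) :
    (a * p + b * q - c) ^ 2 / (a * p + b * q) ≤ a * ((p - c) ^ 2 / p) + b * ((q - c) ^ 2 / q) := by
  rcases eq_or_ne c 0 with rfl | hc
  · simp [pow_two]
  have hp' : 0 < p := hp.lt_of_ne fun h => hc (hpc h.symm)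
  have hq' : 0 < q := hq.lt_of_ne fun h => hc (hqc h.symm)
  obtain rfl : b = 1 - a := by linarith
  have hpos : 0 < a * p + (1 - a) * q := by
    rcases ha.eq_or_lt with rfl | ha'
    · simpa using hq'
    · have := mul_pos ha' hp'
      have := mul_nonneg hb hq
      linarith
  have key : a * ((p - c) ^ 2 / p) + (1 - a) * ((q - c) ^ 2 / q) -
      (a * p + (1 - a) * q - c) ^ 2 / (a * p + (1 - a) * q) =
      a * (1 - a) * (c * (p - q)) ^ 2 / (p * q * (a * p + (1 - a) * q)) := by
    field_simp
    ring
  have : 0 ≤ a * (1 - a) * (c * (p - q)) ^ 2 / (p * q * (a * p + (1 - a) * q)) := by positivity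
  linarith

/-- Strong duality with attainment for linear optimization over a `χ²`-ball of positive radius. -/
theorem exists_chiSquareDualFeasible_of_pos {c g : ι → ℝ} {ρ v : ℝ} (hc : ∀ l, 0 ≤ c l)
    (hc1 : ∑ l, c l = 1) (hρ : 0 < ρ) (hv : ∀ p ∈ chiSquareBall c ρ, p ⬝ᵥ g ≤ v) :
    ∃ lam eta r, ChiSquareDualFeasible g lam eta r ∧
      eta + ρ * lam + 2 * lam - 2 * ∑ l, c l * r l ≤ v := by
  classical
  -- The first two coordinates perturb the total mass and the radius; the last lies below the
  -- objective value.
  let K : Set ((ℝ × ℝ) × ℝ) := {k | ∃ p : ι → ℝ, (∀ l, 0 ≤ p l) ∧ (∀ l, p l = 0 → c l = 0) ∧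
    ∑ l, p l - 1 = k.1.1 ∧ ∑ l, (p l - c l) ^ 2 / p l - ρ ≤ k.1.2 ∧ k.2 ≤ p ⬝ᵥ g}
  have hK : Convex ℝ K := by
    rintro ⟨⟨w₁, w₂⟩, t⟩ ⟨p, hp, hpc, h1, h2, h3⟩ ⟨⟨x₁, x₂⟩, u⟩ ⟨q, hq, hqc, h4, h5, h6⟩
      a b ha hb hab
    simp only at h1 h2 h3 h4 h5 h6
    refine ⟨a • p + b • q, fun l => ?_, fun l hl => ?_, ?_, ?_, ?_⟩
    · have := mul_nonneg ha (hp l)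
      have := mul_nonneg hb (hq l)
      simp only [Pi.add_apply, Pi.smul_apply, smul_eq_mul]
      linarith
    · have h7 := mul_nonneg ha (hp l)
      have h8 := mul_nonneg hb (hq l)
      simp only [Pi.add_apply, Pi.smul_apply, smul_eq_mul] at hl
      rcases ha.eq_or_lt with rfl | ha'
      · have hb1 : b = 1 := by linarith
        exact hqc l (by simpa [hb1] using hl)
      · have : a * p l = 0 := by linarith
        exact hpc l ((mul_eq_zero.1 this).resolve_left ha'.ne')
    · simp only [Pi.add_apply, Pi.smul_apply, smul_eq_mul, Finset.sum_add_distrib,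
        ← Finset.mul_sum, Prod.fst_add, Prod.smul_fst, ← h1, ← h4]
      linear_combination hab
    · have h7 : ∑ l, (a * p l + b * q l - c l) ^ 2 / (a * p l + b * q l) ≤
          ∑ l, (a * ((p l - c l) ^ 2 / p l) + b * ((q l - c l) ^ 2 / q l)) :=
        Finset.sum_le_sum fun l _ =>
          chiSquare_term_convex (hp l) (hq l) (hpc l) (hqc l) ha hb hab
      rw [Finset.sum_add_distrib, ← Finset.mul_sum, ← Finset.mul_sum] at h7
      have h8 := mul_le_mul_of_nonneg_left h2 ha
      have h9 := mul_le_mul_of_nonneg_left h5 hb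
      have h10 : a * ρ + b * ρ = ρ := by rw [← add_mul, hab, one_mul]
      simp only [Pi.add_apply, Pi.smul_apply, smul_eq_mul, Prod.fst_add, Prod.smul_fst,
        Prod.snd_add, Prod.smul_snd]
      linarith
    · have h8 := mul_le_mul_of_nonneg_left h3 ha
      have h9 := mul_le_mul_of_nonneg_left h6 hb
      simp only [add_dotProduct, smul_dotProduct, smul_eq_mul, Prod.snd_add, Prod.smul_snd]
      linarith
  have hg : ∀ t, ((0 : ℝ × ℝ), t) ∈ K → t ≤ v := by
    rintro t ⟨p, hp, hpc, h1, h2, h3⟩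
    simp only [Prod.fst_zero, Prod.snd_zero] at h1 h2 h3
    exact h3.trans (hv p ⟨hp, by linarith, hpc, by linarith⟩)
  -- Slater's condition: `(1 - ε w₁) • c` has mass defect `ε w₁` and `χ²`-distance `(ε w₁)² / (1 - ε
  -- w₁)`, which leaves room below `ρ > 0` for small `ε`.
  have hcore : ∀ k ∈ K, ∃ ε : ℝ, 0 < ε ∧ ∃ t, (-(ε • k.1), t) ∈ K := by
    rintro ⟨⟨w₁, w₂⟩, t⟩ -
    have hlim : ContinuousAt
        (fun ε : ℝ => ((ε * w₁) ^ 2 / (1 - ε * w₁) + ε * w₂, 1 - ε * w₁)) 0 := by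
      have : (1 : ℝ) - 0 * w₁ ≠ 0 := by simp
      fun_prop (disch := assumption)
    have hev := hlim.tendsto.eventually (((isOpen_Iio (a := ρ)).prod
      (isOpen_Ioi (a := (0 : ℝ)))).mem_nhds (by simp [hρ]))
    obtain ⟨ε, ⟨hε1, hε2⟩, hε⟩ := ((hev.filter_mono nhdsWithin_le_nhds).and
      (self_mem_nhdsWithin (s := Set.Ioi (0 : ℝ)))).exists
    simp only [Set.mem_Iio, Set.mem_Ioi] at hε1 hε2 hε
    refine ⟨ε, hε, _, (1 - ε * w₁) • c, fun l => mul_nonneg hε2.le (hc l), fun l hl => ?_, ?_, ?_,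
      le_rfl⟩
    · exact (mul_eq_zero.1 hl).resolve_left hε2.ne'
    · simp [← Finset.mul_sum, hc1]
    · have : ∀ l, (((1 - ε * w₁) • c) l - c l) ^ 2 / ((1 - ε * w₁) • c) l =
          (ε * w₁) ^ 2 / (1 - ε * w₁) * c l := fun l => by
        simp only [Pi.smul_apply, smul_eq_mul]
        rcases eq_or_ne (c l) 0 with h0 | h0
        · simp [h0]
        · field_simp
          ring
      simp only [this, ← Finset.mul_sum, hc1, Prod.smul_mk, Prod.neg_mk, smul_eq_mul]
      linarith
  obtain ⟨φ, hφ⟩ := exists_supergradient hK hg hcore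
  let eta := φ (1, 0)
  let lam := φ (0, 1)
  have hφe : ∀ w : ℝ × ℝ, φ w = w.1 * eta + w.2 * lam := fun w => by
    have : w = w.1 • ((1 : ℝ), (0 : ℝ)) + w.2 • ((0 : ℝ), (1 : ℝ)) := by simp
    conv_lhs => rw [this, map_add, map_smul, map_smul]
    rfl
  -- `K` is unbounded upwards in the radius coordinate.
  have hlam : 0 ≤ lam := by
    by_contra hneg
    push Not at hneg
    have hmem : ∀ n : ℝ, 0 ≤ n → (((0 : ℝ), n), c ⬝ᵥ g) ∈ K := fun n hn =>
      ⟨c, hc, fun _ h => h, by simp [hc1], by simp; linarith, le_rfl⟩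
    have h1 := hφ _ (hmem 0 le_rfl)
    have h2 := hφ _ (hmem ((v - c ⬝ᵥ g + 1) / (-lam)) (by
      simp only [hφe] at h1
      exact div_nonneg (by linarith) (by linarith)))
    have h3 : (v - c ⬝ᵥ g + 1) / (-lam) * lam = -(v - c ⬝ᵥ g + 1) := by
      rw [div_neg, neg_mul, div_mul_cancel₀ _ hneg.ne]
    simp only [hφe, h3] at h2
    linarith
  have hbound : ∀ p : ι → ℝ, (∀ l, 0 ≤ p l) → (∀ l, p l = 0 → c l = 0) →
      ∑ l, (p l * (g l - eta) - lam * ((p l - c l) ^ 2 / p l)) ≤ v - eta - lam * ρ := by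
    intro p hp hpc
    have := hφ ((∑ l, p l - 1, ∑ l, (p l - c l) ^ 2 / p l - ρ), p ⬝ᵥ g)
      ⟨p, hp, hpc, rfl, le_rfl, le_rfl⟩
    rw [hφe] at this
    simp only [mul_sub, Finset.sum_sub_distrib, ← Finset.mul_sum, ← Finset.sum_mul]
    simp only [dotProduct] at this
    linarith
  -- Adding mass `n` at `l` to `c` costs at most `n` in `χ²`-distance, so a larger slope would make
  -- the Lagrangian unbounded.
  have hslope : ∀ l, g l - eta ≤ lam := by
    intro l
    by_contra hlt
    push Not at hlt
    have h1 : ∀ n : ℝ, 0 < n →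
        ∑ k, c k * (g k - eta) + n * (g l - eta - lam) ≤ v - eta - lam * ρ := by
      intro n hn
      have h2 := hbound (fun k => c k + (Pi.single l n : ι → ℝ) k)
        (fun k => add_nonneg (hc k) ((Pi.single_nonneg.2 hn.le : (0 : ι → ℝ) ≤ _) k))
        (fun k hk => by
          have := hc k
          have : 0 ≤ (Pi.single l n : ι → ℝ) k := (Pi.single_nonneg.2 hn.le : (0 : ι → ℝ) ≤ _) k
          linarith)
      refine le_trans ?_ h2
      have h3 : n * (g l - eta - lam) =
          ∑ k, (Pi.single l n : ι → ℝ) k * (g k - eta - lam) := by simp [Pi.single_apply]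
      rw [h3, ← Finset.sum_add_distrib]
      refine Finset.sum_le_sum fun k _ => ?_
      have h4 : 0 ≤ (Pi.single l n : ι → ℝ) k := (Pi.single_nonneg.2 hn.le : (0 : ι → ℝ) ≤ _) k
      have h5 : (c k + (Pi.single l n : ι → ℝ) k - c k) ^ 2 / (c k + (Pi.single l n : ι → ℝ) k) ≤
          (Pi.single l n : ι → ℝ) k := by
        rw [add_sub_cancel_left]
        refine div_le_of_le_mul₀ (add_nonneg (hc k) h4) h4 ?_
        nlinarith [mul_nonneg h4 (hc k)]
      have h6 := mul_le_mul_of_nonneg_left h5 hlam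
      linarith
    have hpos : 0 < g l - eta - lam := by linarith
    let d := v - eta - lam * ρ - ∑ k, c k * (g k - eta)
    have h7 := h1 ((|d| + 1) / (g l - eta - lam)) (by positivity)
    rw [div_mul_cancel₀ _ hpos.ne'] at h7
    have := le_abs_self d
    simp only [d] at this h7
    linarith
  let a : ι → ℝ := fun l => lam - (g l - eta)
  have ha : ∀ l, 0 ≤ a l := fun l => sub_nonneg.2 (hslope l)
  refine ⟨lam, eta, fun l => √(lam * a l), ⟨hlam, hslope, fun l => ?_⟩, ?_⟩
  · rw [Real.sq_sqrt (mul_nonneg hlam (ha l))]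
  -- The Lagrangian is maximized formally at `c √(lam / a)`. Adding `δ` to `lam` and `a` keeps this
  -- point defined and positive wherever `c` is, and the limit `δ → 0` recovers the bound.
  have happrox : ∀ δ : ℝ, 0 < δ →
      ∑ l, c l * (2 * lam - 2 * √((lam + δ) * (a l + δ))) ≤ v - eta - lam * ρ := by
    intro δ hδ
    let A := √(lam + δ)
    let B : ι → ℝ := fun l => √(a l + δ)
    have hA : 0 < A := Real.sqrt_pos.2 (by linarith)
    have hB : ∀ l, 0 < B l := fun l => Real.sqrt_pos.2 (by linarith [ha l])
    have hA2 : A ^ 2 = lam + δ := Real.sq_sqrt (by linarith)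
    have hB2 : ∀ l, B l ^ 2 = a l + δ := fun l => Real.sq_sqrt (by linarith [ha l])
    refine le_trans (Finset.sum_le_sum fun l _ => ?_)
      (hbound (fun l => A / B l * c l) (fun l => mul_nonneg (div_pos hA (hB l)).le (hc l))
        (fun l h => (mul_eq_zero.1 h).resolve_left (div_pos hA (hB l)).ne'))
    have h1 : √((lam + δ) * (a l + δ)) = A * B l := Real.sqrt_mul (by linarith) _
    have hBl := hB l
    have h2 : (A / B l * c l - c l) ^ 2 / (A / B l * c l) =
        c l * (A / B l - 2 + B l / A) := by
      rcases eq_or_ne (c l) 0 with h0 | h0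
      · simp [h0]
      · field_simp
        ring
    have h3 : g l - eta = lam - a l := by simp [a]
    rw [h1, h2, h3]
    have h4 : a l * (A / B l) ≤ A * B l := by
      rw [← mul_div_assoc, div_le_iff₀ hBl]
      nlinarith [hB2 l]
    have h5 : lam * (B l / A) ≤ A * B l := by
      rw [← mul_div_assoc, div_le_iff₀ hA]
      nlinarith
    have h6 := mul_le_mul_of_nonneg_left (add_le_add h4 h5) (hc l)
    linarith
  have hlim : Filter.Tendsto (fun δ : ℝ => ∑ l, c l * (2 * lam - 2 * √((lam + δ) * (a l + δ))))
      (nhdsWithin 0 (Set.Ioi 0)) (nhds (∑ l, c l * (2 * lam - 2 * √(lam * a l)))) := by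
    have hcont : Continuous
        (fun δ : ℝ => ∑ l, c l * (2 * lam - 2 * √((lam + δ) * (a l + δ)))) := by fun_prop
    have := hcont.tendsto 0
    simp only [add_zero] at this
    exact this.mono_left nhdsWithin_le_nhds
  have hfin := le_of_tendsto hlim (by
    filter_upwards [self_mem_nhdsWithin] with δ hδ using happrox δ hδ)
  have hsum : ∑ l, c l * (2 * lam - 2 * √(lam * a l)) =
      2 * lam - 2 * ∑ l, c l * √(lam * a l) := by
    have : ∀ l, c l * (2 * lam - 2 * √(lam * a l)) =
      c l * (2 * lam) - 2 * (c l * √(lam * a l)) := fun l => by ring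
    simp only [this, Finset.sum_sub_distrib, ← Finset.mul_sum, ← Finset.sum_mul, hc1, one_mul]
  rw [hsum] at hfin
  linarith

/-- Strong duality for linear optimization over a `χ²`-ball. -/
theorem exists_chiSquareDualFeasible_lt {c g : ι → ℝ} {ρ v : ℝ} (hc : ∀ l, 0 ≤ c l)
    (hc1 : ∑ l, c l = 1) (hρ : 0 ≤ ρ) (hv : ∀ p ∈ chiSquareBall c ρ, p ⬝ᵥ g ≤ v)
    {ε : ℝ} (hε : 0 < ε) :
    ∃ lam eta r, ChiSquareDualFeasible g lam eta r ∧
      eta + ρ * lam + 2 * lam - 2 * ∑ l, c l * r l ≤ v + ε := by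
  rcases hρ.eq_or_lt with rfl | hρ'
  · have hcv := hv c (self_mem_chiSquareBall hc hc1 le_rfl)
    let s : ι → ℝ := fun l => g l - c ⬝ᵥ g
    have hsum2 : 0 ≤ ∑ l, c l * s l ^ 2 :=
      Finset.sum_nonneg fun l _ => mul_nonneg (hc l) (sq_nonneg _)
    have hsum3 : 0 ≤ ∑ l, |s l| := Finset.sum_nonneg fun l _ => abs_nonneg _
    -- Large enough that `|s l| ≤ lam` and that the final error `(∑ c s²) / lam` is at most `ε`.
    let lam := 1 + ∑ l, |s l| + (∑ l, c l * s l ^ 2) / ε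
    have hlam : 0 < lam := by positivity
    have habs : ∀ l, |s l| ≤ lam := fun l => by
      have h1 := Finset.single_le_sum (f := fun l => |s l|) (fun l _ => abs_nonneg _)
        (Finset.mem_univ l)
      have h2 : 0 ≤ (∑ l, c l * s l ^ 2) / ε := by positivity
      simp only [lam]
      linarith
    have hmul : (∑ l, c l * s l ^ 2) / lam ≤ ε := by
      rw [div_le_iff₀ hlam]
      have : ε * ((∑ l, c l * s l ^ 2) / ε) = ∑ l, c l * s l ^ 2 := by field_simp
      have h2 : 0 ≤ ε * (1 + ∑ l, |s l|) := by positivity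
      simp only [lam, mul_add ε (1 + _)]
      linarith
    -- Here `r` is a lower estimate of `√(lam (lam - s))`: its expansion to first order, minus a
    -- quadratic term large enough for all `|s| ≤ lam`. The linear term averages to zero because
    -- `eta` is the mean of `g`.
    refine ⟨lam, c ⬝ᵥ g, fun l => lam - s l / 2 - s l ^ 2 / (2 * lam), ⟨hlam.le, fun l =>
      (le_abs_self _).trans (habs l), fun l => ?_⟩, ?_⟩
    · change _ ≤ lam * (lam - s l)
      obtain ⟨h1, h2⟩ := abs_le.1 (habs l)
      have h3 : lam * (lam - s l) - (lam - s l / 2 - s l ^ 2 / (2 * lam)) ^ 2 =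
          (lam - s l) * (s l ^ 2 * (3 * lam + s l)) / (4 * lam ^ 2) := by
        field_simp
        ring
      have h4 : 0 ≤ (lam - s l) * (s l ^ 2 * (3 * lam + s l)) / (4 * lam ^ 2) :=
        div_nonneg (mul_nonneg (by linarith) (mul_nonneg (sq_nonneg _) (by linarith)))
          (by positivity)
      linarith
    · have h1 : ∀ l, c l * (lam - s l / 2 - s l ^ 2 / (2 * lam)) =
          c l * lam - (c l * s l) / 2 - (c l * s l ^ 2) / lam / 2 := fun l => by
        field_simp
      have h2 : ∑ l, c l * s l = 0 := by
        simp only [s, mul_sub, Finset.sum_sub_distrib, ← Finset.sum_mul, hc1, one_mul]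
        exact sub_self _
      simp only [h1, Finset.sum_sub_distrib, ← Finset.sum_div, ← Finset.sum_mul, hc1, h2]
      linarith
  · obtain ⟨lam, eta, r, h, hle⟩ := exists_chiSquareDualFeasible_of_pos hc hc1 hρ' hv
    exact ⟨lam, eta, r, h, by linarith⟩

end ChiSquare

/-! ### Recourse function and moment duality for a single mode -/

/-- The maximum of a linear function over a box, in terms of nonnegative multipliers. -/
theorem exists_box_multipliers {ι : Type*} [Fintype ι] (w : ι → ℝ) {lo hi : ι → ℝ}
    (h : lo ≤ hi) : ∃ βlo βhi : ι → ℝ, 0 ≤ βlo ∧ 0 ≤ βhi ∧ βhi - βlo = w ∧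
      ∃ b ∈ Set.Icc lo hi, βhi ⬝ᵥ hi - βlo ⬝ᵥ lo = w ⬝ᵥ b := by
  refine ⟨fun i => max (-w i) 0, fun i => max (w i) 0, fun i => le_max_right _ _,
    fun i => le_max_right _ _, ?_, fun i => if 0 ≤ w i then hi i else lo i,
    ⟨fun i => ?_, fun i => ?_⟩, ?_⟩
  · ext i
    rcases le_total 0 (w i) with h | h <;> simp [h]
  · dsimp only
    split_ifs
    exacts [h i, le_rfl]
  · dsimp only
    split_ifs
    exacts [le_rfl, h i]
  · simp only [dotProduct, ← Finset.sum_sub_distrib]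
    refine Finset.sum_congr rfl fun i _ => ?_
    split_ifs with h0
    · simp [h0]
    · push Not at h0
      simp [h0.le]

namespace D3RO

variable {I J N S L M : ℕ} (D : D3RO I J N S L M)

/-- Continuity makes `h y` integrable and bounded on compact supports. -/
theorem continuousOn_h {y : Fin I → ℝ} {s : Set (Fin N → ℝ)}
    (hne : ∀ ξ ∈ s, (D.secondStageSet y ξ).Nonempty)
    (hbdd : ∀ ξ ∈ s, BddBelow (D.secondStageCost ξ '' D.secondStageSet y ξ)) :
    ContinuousOn (D.h y) s := by
  have hset : ∀ ξ, D.secondStageSet y ξ = {x | D.R y - D.T y *ᵥ ξ ≤ D.W *ᵥ x} := fun ξ => by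
    ext x
    exact (sub_le_iff_le_add' (a := D.R y) (b := D.T y *ᵥ ξ) (c := D.W *ᵥ x)).symm
  have key := continuousOn_linearProgram_value (s := s) D.W
    (b := fun ξ => D.R y - D.T y *ᵥ ξ) (c := fun ξ => D.Q *ᵥ ξ + D.q)
    (by fun_prop) (by fun_prop) (fun ξ hξ => by rw [← hset]; exact hne ξ hξ)
    (fun ξ hξ => by rw [← hset]; exact hbdd ξ hξ)
  simp only [← hset] at key
  exact key

section Moments

variable {D} {l : Fin L}

theorem integrable_of_mem_momentMeasures (hXi : IsCompact (D.Xi l)) {h : (Fin N → ℝ) → ℝ}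
    (hh : ContinuousOn h (D.Xi l)) {P : Measure (Fin N → ℝ)} (hP : P ∈ D.momentMeasures l) :
    Integrable h P := by
  obtain ⟨hprob, hsupp, -⟩ := hP
  have hres : P.restrict (D.Xi l) = P := Measure.restrict_eq_self_of_ae_mem hsupp
  have := hh.integrableOn_compact (μ := P) hXi
  rwa [IntegrableOn, hres] at this

/-- Testing an inequality between integrals on Dirac measures gives the constraint at each `ξ`.
Singletons are measurable, so no measurability of the moment functions is needed. -/
theorem dirac_mem_momentMeasures (hXi : IsCompact (D.Xi l)) {ξ : Fin N → ℝ} (hξ : ξ ∈ D.Xi l) :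
    Measure.dirac ξ ∈ D.momentMeasures l := by
  refine ⟨inferInstance, ?_, fun m => integrable_dirac (by simp)⟩
  rw [Measure.dirac_apply' _ hXi.measurableSet.compl]
  simp [hξ]

theorem convexComb_mem_momentMeasures {P P' : Measure (Fin N → ℝ)} (hP : P ∈ D.momentMeasures l)
    (hP' : P' ∈ D.momentMeasures l) {a b : ℝ} (ha : 0 ≤ a) (hb : 0 ≤ b) (hab : a + b = 1) :
    ENNReal.ofReal a • P + ENNReal.ofReal b • P' ∈ D.momentMeasures l := by
  obtain ⟨h1, h2, h3⟩ := hP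
  obtain ⟨h4, h5, h6⟩ := hP'
  refine ⟨⟨?_⟩, ?_, fun m => ?_⟩
  · simp [← ENNReal.ofReal_add ha hb, hab]
  · simp [h2, h5]
  · exact ((h3 m).smul_measure ENNReal.ofReal_ne_top).add_measure
      ((h6 m).smul_measure ENNReal.ofReal_ne_top)

theorem integral_convexComb {h : (Fin N → ℝ) → ℝ} {P P' : Measure (Fin N → ℝ)}
    (hP : Integrable h P) (hP' : Integrable h P') {a b : ℝ} (ha : 0 ≤ a) (hb : 0 ≤ b) :
    ∫ ξ, h ξ ∂(ENNReal.ofReal a • P + ENNReal.ofReal b • P') =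
      a * ∫ ξ, h ξ ∂P + b * ∫ ξ, h ξ ∂P' := by
  rw [integral_add_measure (hP.smul_measure ENNReal.ofReal_ne_top)
    (hP'.smul_measure ENNReal.ofReal_ne_top), integral_smul_measure, integral_smul_measure,
    ENNReal.toReal_ofReal ha, ENNReal.toReal_ofReal hb, smul_eq_mul, smul_eq_mul]

theorem momentVector_convexComb {P P' : Measure (Fin N → ℝ)} (hP : P ∈ D.momentMeasures l)
    (hP' : P' ∈ D.momentMeasures l) {a b : ℝ} (ha : 0 ≤ a) (hb : 0 ≤ b) :
    D.momentVector (ENNReal.ofReal a • P + ENNReal.ofReal b • P') =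
      a • D.momentVector P + b • D.momentVector P' := by
  ext m
  simp only [momentVector, Pi.add_apply, Pi.smul_apply, smul_eq_mul]
  exact integral_convexComb (hP.2.2 m) (hP'.2.2 m) ha hb

theorem momentVector_dirac (ξ : Fin N → ℝ) :
    D.momentVector (Measure.dirac ξ) = fun m => D.f m ξ := by
  ext m
  simp [momentVector]

/-- Mixing measures mixes moments and expected cost simultaneously; the joint image is the convex
set on which both strong duality proofs operate. -/
theorem convex_image_momentMeasures (hXi : IsCompact (D.Xi l)) {h : (Fin N → ℝ) → ℝ}
    (hh : ContinuousOn h (D.Xi l)) :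
    Convex ℝ ((fun P => (D.momentVector P, ∫ ξ, h ξ ∂P)) '' D.momentMeasures l) := by
  rintro _ ⟨P, hP, rfl⟩ _ ⟨P', hP', rfl⟩ a b ha hb hab
  refine ⟨_, convexComb_mem_momentMeasures hP hP' ha hb hab, ?_⟩
  simp only [momentVector_convexComb hP hP' ha hb,
    integral_convexComb (integrable_of_mem_momentMeasures hXi hh hP)
      (integrable_of_mem_momentMeasures hXi hh hP') ha hb]
  rfl

/-- A pointwise bound by an affine function of the moment functions can be integrated. -/
theorem integral_le_of_le_affine {h : (Fin N → ℝ) → ℝ} {P : Measure (Fin N → ℝ)}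
    (hP : P ∈ D.momentMeasures l) (hh : Integrable h P) {α : ℝ} {w : Fin M → ℝ}
    (hle : ∀ ξ ∈ D.Xi l, h ξ ≤ α + w ⬝ᵥ fun m => D.f m ξ) :
    ∫ ξ, h ξ ∂P ≤ α + w ⬝ᵥ D.momentVector P := by
  obtain ⟨hprob, hsupp, hint⟩ := hP
  have hint' : ∀ m ∈ Finset.univ, Integrable (fun ξ => w m * D.f m ξ) P :=
    fun m _ => (hint m).const_mul _
  calc ∫ ξ, h ξ ∂P ≤ ∫ ξ, (α + ∑ m, w m * D.f m ξ) ∂P := by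
        refine integral_mono_ae hh ((integrable_const α).add (integrable_finsetSum _ hint')) ?_
        have hae : ∀ᵐ ξ ∂P, ξ ∈ D.Xi l := hsupp
        filter_upwards [hae] with ξ hξ using hle ξ hξ
    _ = _ := by
        rw [integral_add (integrable_const α) (integrable_finsetSum _ hint'),
          integral_finsetSum _ hint']
        simp only [integral_const_mul, integral_const, probReal_univ, one_smul]
        rfl

/-- Dual solutions of value at most `g` for the maximization of `∫ h dℙ` over the ambiguity set of
mode `l`. -/
structure MomentDualFeasible (D : D3RO I J N S L M) (l : Fin L) (y : Fin I → ℝ)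
    (h : (Fin N → ℝ) → ℝ) (g : ℝ) (α : ℝ) (βlo βhi : Fin M → ℝ) : Prop where
  lo_nonneg : 0 ≤ βlo
  hi_nonneg : 0 ≤ βhi
  value_le : α + βhi ⬝ᵥ D.uHi y l - βlo ⬝ᵥ D.uLo y l ≤ g
  support : ∀ ξ ∈ D.Xi l, h ξ ≤ α + (βhi - βlo) ⬝ᵥ fun m => D.f m ξ

variable {y : Fin I → ℝ} {h : (Fin N → ℝ) → ℝ} {g : ℝ}

theorem MomentDualFeasible.integral_le {α : ℝ} {βlo βhi : Fin M → ℝ}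
    (hdual : D.MomentDualFeasible l y h g α βlo βhi) {P : Measure (Fin N → ℝ)}
    (hP : P ∈ D.ambiguitySet l y) (hh : Integrable h P) : ∫ ξ, h ξ ∂P ≤ g := by
  refine (integral_le_of_le_affine hP.1 hh hdual.support).trans (le_trans ?_ hdual.value_le)
  have h1 : βhi ⬝ᵥ D.momentVector P ≤ βhi ⬝ᵥ D.uHi y l :=
    dotProduct_le_dotProduct_of_nonneg_left (fun m => (hP.2 m).2) hdual.hi_nonneg
  have h2 : βlo ⬝ᵥ D.uLo y l ≤ βlo ⬝ᵥ D.momentVector P :=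
    dotProduct_le_dotProduct_of_nonneg_left (fun m => (hP.2 m).1) hdual.lo_nonneg
  rw [sub_dotProduct]
  linarith

/-- An affine majorant of `h` in the moments whose maximum over the box of moment bounds is at most
`g` provides a dual solution. -/
theorem exists_momentDualFeasible_of_affine (hlohi : D.uLo y l ≤ D.uHi y l) {α : ℝ}
    {w : Fin M → ℝ} (hbox : ∀ b ∈ Set.Icc (D.uLo y l) (D.uHi y l), α + w ⬝ᵥ b ≤ g)
    (hle : ∀ ξ ∈ D.Xi l, h ξ ≤ α + w ⬝ᵥ fun m => D.f m ξ) :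
    ∃ βlo βhi, D.MomentDualFeasible l y h g α βlo βhi := by
  obtain ⟨βlo, βhi, h1, h2, rfl, b, hb, h3⟩ := exists_box_multipliers w hlohi
  exact ⟨βlo, βhi, h1, h2, by linarith [hbox b hb], hle⟩

theorem uLo_le_uHi_of_mem_ambiguitySet {P : Measure (Fin N → ℝ)} (hP : P ∈ D.ambiguitySet l y) :
    D.uLo y l ≤ D.uHi y l :=
  fun m => (hP.2 m).1.trans (hP.2 m).2

open scoped Pointwise in
/-- Strong moment duality with attainment under the relative interior condition. -/
theorem exists_momentDualFeasible_of_relInterior (hXi : IsCompact (D.Xi l))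
    (hh : ContinuousOn h (D.Xi l)) (hrel : (D.relInteriorAmbiguitySet l y).Nonempty)
    (hg : ∀ P ∈ D.ambiguitySet l y, ∫ ξ, h ξ ∂P ≤ g) :
    ∃ α βlo βhi, D.MomentDualFeasible l y h g α βlo βhi := by
  classical
  obtain ⟨P₀, hP₀, hbox₀, hmom₀⟩ := hrel
  have hlohi := uLo_le_uHi_of_mem_ambiguitySet hP₀
  -- Moments are compared with an arbitrary point of the box, so the fibre over `0` consists of the
  -- expectations over the ambiguity set.
  let K : Set ((Fin M → ℝ) × ℝ) := {k | ∃ P ∈ D.momentMeasures l,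
    ∃ b ∈ Set.Icc (D.uLo y l) (D.uHi y l), k = (D.momentVector P - b, ∫ ξ, h ξ ∂P)}
  have hK : Convex ℝ K := by
    have : K = (fun P => (D.momentVector P, ∫ ξ, h ξ ∂P)) '' D.momentMeasures l -
        Set.Icc (D.uLo y l) (D.uHi y l) ×ˢ {(0 : ℝ)} := by
      ext k
      simp only [K, Set.mem_sub, Set.mem_ofPred_eq]
      constructor
      · rintro ⟨P, hP, b, hb, rfl⟩
        exact ⟨_, ⟨P, hP, rfl⟩, (b, 0), ⟨hb, rfl⟩, by simp⟩
      · rintro ⟨_, ⟨P, hP, rfl⟩, ⟨b, t⟩, ⟨hb, ht⟩, rfl⟩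
        obtain rfl : t = 0 := ht
        exact ⟨P, hP, b, hb, by simp⟩
    rw [this]
    exact (convex_image_momentMeasures hXi hh).sub
      ((convex_Icc _ _).prod (convex_singleton _))
  have hgK : ∀ t, ((0 : Fin M → ℝ), t) ∈ K → t ≤ g := by
    rintro t ⟨P, hP, b, hb, heq⟩
    rw [Prod.mk.injEq] at heq
    rw [heq.2]
    refine hg P ⟨hP, fun m => ?_⟩
    rw [sub_eq_zero.1 heq.1.symm]
    exact ⟨hb.1 m, hb.2 m⟩
  -- The moment vector of `P₀` is relatively interior to both convex sets, so the segments from `b`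
  -- and from the moments of `P` can be prolonged beyond it by the same `ε`. The difference of the
  -- two endpoints is `-ε` times the original one.
  have hcore : ∀ k ∈ K, ∃ ε : ℝ, 0 < ε ∧ ∃ t, (-(ε • k.1), t) ∈ K := by
    rintro _ ⟨P, hP, b, hb, rfl⟩
    have e1 := eventually_add_smul_sub_mem_of_mem_intrinsicInterior hbox₀ hb
    have e2 := eventually_add_smul_sub_mem_of_mem_intrinsicInterior hmom₀
      (Set.mem_image_of_mem _ hP)
    obtain ⟨ε, ⟨hb', P', hP', hm⟩, hε⟩ := (((e1.and e2).filter_mono nhdsWithin_le_nhds).and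
      (self_mem_nhdsWithin (s := Set.Ioi (0 : ℝ)))).exists
    refine ⟨ε, hε, _, P', hP', _, hb', Prod.ext ?_ rfl⟩
    simp only [hm, smul_sub]
    abel
  obtain ⟨φ, hφ⟩ := exists_supergradient hK hgK hcore
  let w : Fin M → ℝ := fun m => φ (Pi.single m 1)
  have hφw : ∀ u, φ u = w ⬝ᵥ u := fun u => by
    rw [LinearMap.pi_apply_eq_sum_univ φ u]
    simp only [dotProduct, w, smul_eq_mul]
    refine Finset.sum_congr rfl fun m _ => ?_
    rw [mul_comm]
    congr 2
    ext i
    simp [Pi.single_apply, eq_comm]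
  obtain ⟨βlo, βhi, h1, h2, h3, b, hb, h4⟩ := exists_box_multipliers w hlohi
  -- `b` maximizes `w` over the box, so the dual value is exactly `g`; the supergradient inequality
  -- at a Dirac measure and this `b` is the support constraint.
  refine ⟨g - w ⬝ᵥ b, βlo, βhi, h1, h2, by linarith, fun ξ hξ => ?_⟩
  have h5 := hφ _ ⟨_, dirac_mem_momentMeasures hXi hξ, b, hb, rfl⟩
  simp only [momentVector_dirac, integral_dirac, hφw, dotProduct_sub] at h5
  rw [h3]
  linarith

/-- Strong moment duality, without attainment, for continuous moment functions. -/
theorem exists_momentDualFeasible_of_continuousOn (hXi : IsCompact (D.Xi l))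
    (hh : ContinuousOn h (D.Xi l)) (hf : ∀ m, ContinuousOn (D.f m) (D.Xi l))
    (hne : (D.ambiguitySet l y).Nonempty)
    (hg : ∀ P ∈ D.ambiguitySet l y, ∫ ξ, h ξ ∂P ≤ g) {ε : ℝ} (hε : 0 < ε) :
    ∃ α βlo βhi, D.MomentDualFeasible l y h (g + ε) α βlo βhi := by
  classical
  obtain ⟨P₀, hP₀⟩ := hne
  have hlohi := uLo_le_uHi_of_mem_ambiguitySet hP₀
  let G : (Fin N → ℝ) → (Fin M → ℝ) × ℝ := fun ξ => (fun m => D.f m ξ, h ξ)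
  have hG : ContinuousOn G (D.Xi l) := (continuousOn_pi.2 hf).prodMk hh
  have hcomp := (hXi.image_of_continuousOn hG).convexHull_of_finiteDimensional
  have hhull : convexHull ℝ (G '' D.Xi l) ⊆
      (fun P => (D.momentVector P, ∫ ξ, h ξ ∂P)) '' D.momentMeasures l := by
    refine convexHull_min ?_ (convex_image_momentMeasures hXi hh)
    rintro _ ⟨ξ, hξ, rfl⟩
    exact ⟨_, dirac_mem_momentMeasures hXi hξ, by simp [momentVector_dirac, G]⟩
  -- A common point would be realized by a measure in the ambiguity set with expectation at least `g
  -- + ε`. This positive gap lets compactness yield strict separation.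
  have hdisj : Disjoint (convexHull ℝ (G '' D.Xi l))
      (Set.Icc (D.uLo y l) (D.uHi y l) ×ˢ Set.Ici (g + ε)) := by
    rw [Set.disjoint_left]
    intro k hk hk'
    obtain ⟨P, hP, rfl⟩ := hhull hk
    have h1 := hg P ⟨hP, fun m => ⟨hk'.1.1 m, hk'.1.2 m⟩⟩
    have h2 : g + ε ≤ ∫ ξ, h ξ ∂P := hk'.2
    linarith
  obtain ⟨F, u, v, hFu, huv, hFv⟩ := geometric_hahn_banach_compact_closed
    (convex_convexHull ℝ _) hcomp ((convex_Icc (D.uLo y l) (D.uHi y l)).prod (convex_Ici (g + ε)))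
    (isClosed_Icc.prod isClosed_Ici) hdisj
  let a : Fin M → ℝ := fun m => F (Pi.single m 1, 0)
  let β : ℝ := F (0, 1)
  have hF : ∀ (p : Fin M → ℝ) (τ : ℝ), F (p, τ) = a ⬝ᵥ p + β * τ := by
    intro p τ
    have h1 : (p, τ) = LinearMap.inl ℝ (Fin M → ℝ) ℝ p + τ • ((0 : Fin M → ℝ), (1 : ℝ)) := by simp
    have h2 : F (LinearMap.inl ℝ (Fin M → ℝ) ℝ p) = a ⬝ᵥ p := by
      have := LinearMap.pi_apply_eq_sum_univ (F.toLinearMap.comp (LinearMap.inl ℝ (Fin M → ℝ) ℝ)) p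
      simp only [LinearMap.comp_apply, ContinuousLinearMap.coe_coe] at this
      rw [this]
      simp only [dotProduct, a, smul_eq_mul]
      refine Finset.sum_congr rfl fun j _ => ?_
      rw [mul_comm]
      congr 2
      simp only [LinearMap.inl_apply, Prod.mk.injEq, and_true]
      ext i
      simp [Pi.single_apply, eq_comm]
    rw [h1, map_add, map_smul, h2]
    simp only [smul_eq_mul, β]
    ring
  have hXiF : ∀ ξ ∈ D.Xi l, a ⬝ᵥ (fun m => D.f m ξ) + β * h ξ < u := fun ξ hξ => by
    rw [← hF]
    exact hFu _ (subset_convexHull ℝ _ ⟨ξ, hξ, rfl⟩)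
  have hboxF : ∀ b ∈ Set.Icc (D.uLo y l) (D.uHi y l), ∀ t, g + ε ≤ t → v < a ⬝ᵥ b + β * t :=
    fun b hb t ht => by
      rw [← hF]
      exact hFv _ ⟨hb, ht⟩
  have hb₀ : D.momentVector P₀ ∈ Set.Icc (D.uLo y l) (D.uHi y l) :=
    ⟨fun m => (hP₀.2 m).1, fun m => (hP₀.2 m).2⟩
  have hβ0 : 0 ≤ β := by
    by_contra hneg
    push Not at hneg
    have h1 := hboxF _ hb₀ (g + ε) le_rfl
    have h2 := hboxF _ hb₀
      (g + ε + (a ⬝ᵥ D.momentVector P₀ + β * (g + ε) - v) / (-β))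
      (le_add_of_nonneg_right (div_nonneg (by linarith) (by linarith)))
    have h3 : β * (g + ε + (a ⬝ᵥ D.momentVector P₀ + β * (g + ε) - v) / (-β)) =
        β * (g + ε) - (a ⬝ᵥ D.momentVector P₀ + β * (g + ε) - v) := by
      field_simp [hneg.ne]
      ring
    linarith
  -- A vertical hyperplane would strictly separate the box from all moment vectors on `Ξₗ`, contrary
  -- to `P₀`; integrating it against `P₀` gives `v < u`.
  have hβ : 0 < β := by
    refine hβ0.lt_of_ne fun h0 => ?_
    have h1 := hboxF _ hb₀ (g + ε) le_rfl
    have h2 := integral_le_of_le_affine (h := fun _ => (0 : ℝ)) (α := u) (w := -a) hP₀.1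
      (integrable_zero _ _ _) (fun ξ hξ => by
        have := hXiF ξ hξ
        rw [← h0] at this
        rw [neg_dotProduct]
        linarith)
    rw [← h0] at h1
    simp only [integral_zero, neg_dotProduct] at h2
    linarith
  refine ⟨v / β, exists_momentDualFeasible_of_affine (w := -(β⁻¹ • a)) hlohi (fun b hb => ?_)
    fun ξ hξ => ?_⟩
  · have h1 := hboxF b hb (g + ε) le_rfl
    rw [neg_dotProduct, smul_dotProduct, smul_eq_mul, ← div_eq_inv_mul, ← sub_eq_add_neg, ← sub_div,
      div_le_iff₀ hβ]
    linarith
  · have h1 := hXiF ξ hξ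
    rw [neg_dotProduct, smul_dotProduct, smul_eq_mul, ← div_eq_inv_mul, ← sub_eq_add_neg, ← sub_div,
      le_div_iff₀ hβ]
    linarith

end Moments

end D3RO

/-! ### Duality for a fixed first-stage decision -/

theorem IsLUB.iSup_coe_ereal {s : Set ℝ} {v : ℝ} (h : IsLUB s v) (hs : s.Nonempty) :
    ⨆ x ∈ s, (x : EReal) = (v : EReal) := by
  refine le_antisymm (iSup₂_le fun x hx => EReal.coe_le_coe_iff.2 (h.1 hx)) ?_
  have hle : ∀ x ∈ s, (x : EReal) ≤ ⨆ x ∈ s, (x : EReal) := fun x hx =>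
    le_iSup₂ (f := fun x (_ : x ∈ s) => (x : EReal)) x hx
  generalize (⨆ x ∈ s, (x : EReal)) = a at hle
  induction a with
  | bot =>
    obtain ⟨x, hx⟩ := hs
    exact absurd (hle x hx) (not_le.2 (EReal.bot_lt_coe x))
  | coe r => exact EReal.coe_le_coe_iff.2 (h.2 fun x hx => EReal.coe_le_coe_iff.1 (hle x hx))
  | top => exact le_top

namespace D3RO

variable {I J N S L M : ℕ} {D : D3RO I J N S L M}

/-- Dual solutions of the moment problems and of the mode probability problem combine to a solution
of the conic reformulation. -/
theorem ConicFeasible.of_duals {y : Fin I → ℝ} (hy : y ∈ D.Y) {ψ : Fin L → ℝ} {lam eta : ℝ}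
    {r : Fin L → ℝ} (hχ : ChiSquareDualFeasible ψ lam eta r) {α : Fin L → ℝ}
    {βlo βhi : Fin L → Fin M → ℝ}
    (hm : ∀ l, D.MomentDualFeasible l y (D.h y) (ψ l) (α l) (βlo l) (βhi l)) :
    D.ConicFeasible y ⟨lam, eta, ψ, r, α, βlo, βhi⟩ where
  mem := hy
  lam_nonneg := hχ.lam_nonneg
  betaLo_nonneg l := (hm l).lo_nonneg
  betaHi_nonneg l := (hm l).hi_nonneg
  moment l := (hm l).value_le
  cone l := (sqrt_add_le_iff_sq_le hχ.lam_nonneg (hχ.slope l)).2 (hχ.sq_le l)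
  slope := hχ.slope
  support l := (hm l).support

theorem ConicFeasible.chiSquareDualFeasible {y : Fin I → ℝ} {z : ConicVars L M}
    (hz : D.ConicFeasible y z) : ChiSquareDualFeasible z.psi z.lam z.eta z.r where
  lam_nonneg := hz.lam_nonneg
  slope := hz.slope
  sq_le l := (sqrt_add_le_iff_sq_le hz.lam_nonneg (hz.slope l)).1 (hz.cone l)

theorem ConicFeasible.momentDualFeasible {y : Fin I → ℝ} {z : ConicVars L M}
    (hz : D.ConicFeasible y z) (l : Fin L) :
    D.MomentDualFeasible l y (D.h y) (z.psi l) (z.alpha l) (z.betaLo l) (z.betaHi l) where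
  lo_nonneg := hz.betaLo_nonneg l
  hi_nonneg := hz.betaHi_nonneg l
  value_le := hz.moment l
  support := hz.support l

section FixedDecision

variable {y : Fin I → ℝ}

/-- Integration is linear in the measure, so the cost of a mixture depends on the modes only through
their separate expectations. -/
theorem mem_expectedCosts_iff (hXi : ∀ l, IsCompact (D.Xi l))
    (hh : ∀ l, ContinuousOn (D.h y) (D.Xi l)) {t : ℝ} :
    t ∈ D.expectedCosts y ↔ ∃ p ∈ D.chiSquareSet y, ∃ Pl : Fin L → Measure (Fin N → ℝ),
      (∀ l, Pl l ∈ D.ambiguitySet l y) ∧ t = p ⬝ᵥ fun l => ∫ ξ, D.h y ξ ∂(Pl l) := by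
  have key : ∀ p ∈ D.chiSquareSet y, ∀ Pl : Fin L → Measure (Fin N → ℝ),
      (∀ l, Pl l ∈ D.ambiguitySet l y) →
      ∫ ξ, D.h y ξ ∂(∑ l, ENNReal.ofReal (p l) • Pl l) =
        p ⬝ᵥ fun l => ∫ ξ, D.h y ξ ∂(Pl l) := by
    intro p hp Pl hPl
    rw [integral_finsetSum_measure fun l _ =>
      (integrable_of_mem_momentMeasures (hXi l) (hh l) (hPl l).1).smul_measure
        ENNReal.ofReal_ne_top]
    refine Finset.sum_congr rfl fun l _ => ?_
    rw [integral_smul_measure, ENNReal.toReal_ofReal (hp.1 l), smul_eq_mul]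
  constructor
  · rintro ⟨_, ⟨p, hp, Pl, hPl, rfl⟩, rfl⟩
    exact ⟨p, hp, Pl, hPl, key p hp Pl hPl⟩
  · rintro ⟨p, hp, Pl, hPl, rfl⟩
    exact ⟨_, ⟨p, hp, Pl, hPl, rfl⟩, key p hp Pl hPl⟩

/-- Weak duality between the worst-case expectation problem and the conic reformulation. -/
theorem ConicFeasible.expectedCost_le {z : ConicVars L M} (hXi : ∀ l, IsCompact (D.Xi l))
    (hh : ∀ l, ContinuousOn (D.h y) (D.Xi l)) (hc : ∀ l, 0 ≤ D.phat y l)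
    (hc1 : ∑ l, D.phat y l = 1) (hz : D.ConicFeasible y z) {t : ℝ}
    (ht : t ∈ D.expectedCosts y) : D.c ⬝ᵥ y + t ≤ D.conicObjective y z := by
  obtain ⟨p, hp, Pl, hPl, rfl⟩ := (mem_expectedCosts_iff hXi hh).1 ht
  have h1 : (p ⬝ᵥ fun l => ∫ ξ, D.h y ξ ∂(Pl l)) ≤ p ⬝ᵥ z.psi :=
    dotProduct_le_dotProduct_of_nonneg_left (fun l => (hz.momentDualFeasible l).integral_le (hPl l)
      (integrable_of_mem_momentMeasures (hXi l) (hh l) (hPl l).1)) hp.1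
  have h2 := hz.chiSquareDualFeasible.dotProduct_le hc hc1 hp
  rw [conicObjective]
  linarith

/-- The worst-case expectation over the ambiguity set of a mode is finite. -/
theorem exists_isLUB_integral {l : Fin L} (hXi : IsCompact (D.Xi l))
    (hh : ContinuousOn (D.h y) (D.Xi l)) (hne : (D.ambiguitySet l y).Nonempty) :
    ∃ g, IsLUB ((fun P => ∫ ξ, D.h y ξ ∂P) '' D.ambiguitySet l y) g := by
  obtain ⟨C, hC⟩ := (hXi.image_of_continuousOn hh).bddAbove
  refine ⟨_, isLUB_csSup (hne.image _) ⟨C, ?_⟩⟩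
  rintro _ ⟨P, hP, rfl⟩
  simpa using integral_le_of_le_affine (α := C) (w := 0) hP.1
    (integrable_of_mem_momentMeasures hXi hh hP.1) fun ξ hξ => by
      simpa using hC (Set.mem_image_of_mem _ hξ)

/-- The worst-case expectation over the mixtures bounds the mixtures of the worst-case expectations
of the modes. -/
theorem dotProduct_le_of_expectedCosts_le (hXi : ∀ l, IsCompact (D.Xi l))
    (hh : ∀ l, ContinuousOn (D.h y) (D.Xi l)) {g : Fin L → ℝ}
    (hg : ∀ l, IsLUB ((fun P => ∫ ξ, D.h y ξ ∂P) '' D.ambiguitySet l y) (g l)) {v : ℝ}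
    (hv : v ∈ upperBounds (D.expectedCosts y)) {p : Fin L → ℝ} (hp : p ∈ D.chiSquareSet y) :
    p ⬝ᵥ g ≤ v := by
  refine le_of_forall_pos_le_add fun ε hε => ?_
  -- The modes need not attain their suprema; since `p` sums to one, `ε`-optimal measures lose only
  -- `ε` in total.
  have hex : ∀ l, ∃ P ∈ D.ambiguitySet l y, g l - ε < ∫ ξ, D.h y ξ ∂P := fun l => by
    obtain ⟨_, ⟨P, hP, rfl⟩, h1, -⟩ := (hg l).exists_between (sub_lt_self (g l) hε)
    exact ⟨P, hP, h1⟩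
  choose Pl hPl hlt using hex
  have h1 := hv ((mem_expectedCosts_iff hXi hh).2 ⟨p, hp, Pl, hPl, rfl⟩)
  have h2 : p ⬝ᵥ g ≤ p ⬝ᵥ ((fun l => ∫ ξ, D.h y ξ ∂(Pl l)) + fun _ => ε) :=
    dotProduct_le_dotProduct_of_nonneg_left (fun l => (sub_lt_iff_lt_add.1 (hlt l)).le) hp.1
  have h3 : (p ⬝ᵥ fun _ => ε) = ε := by
    simp only [dotProduct, ← Finset.sum_mul, hp.2.1, one_mul]
  rw [dotProduct_add, h3] at h2
  linarith

/-- The worst-case expectation over the mixtures is finite. -/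
theorem exists_isLUB_expectedCosts (hXi : ∀ l, IsCompact (D.Xi l)) (hrho : 0 ≤ D.rho)
    (hh : ∀ l, ContinuousOn (D.h y) (D.Xi l)) (hc : ∀ l, 0 ≤ D.phat y l)
    (hc1 : ∑ l, D.phat y l = 1) (hne : ∀ l, (D.ambiguitySet l y).Nonempty) :
    (D.expectedCosts y).Nonempty ∧ ∃ v, IsLUB (D.expectedCosts y) v := by
  have hne' : (D.expectedCosts y).Nonempty := by
    choose Pl hPl using hne
    exact ⟨_, (mem_expectedCosts_iff hXi hh).2
      ⟨_, self_mem_chiSquareBall hc hc1 hrho, Pl, hPl, rfl⟩⟩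
  choose g hg using fun l => exists_isLUB_integral (hXi l) (hh l) (hne l)
  refine ⟨hne', _, isLUB_csSup hne' ⟨∑ l, |g l|, fun t ht => ?_⟩⟩
  obtain ⟨p, hp, Pl, hPl, rfl⟩ := (mem_expectedCosts_iff hXi hh).1 ht
  refine Finset.sum_le_sum fun l _ => ?_
  have hp1 : p l ≤ 1 := hp.2.1 ▸ Finset.single_le_sum (fun l _ => hp.1 l) (Finset.mem_univ l)
  calc p l * ∫ ξ, D.h y ξ ∂(Pl l) ≤ p l * |g l| :=
        mul_le_mul_of_nonneg_left (((hg l).1 ⟨Pl l, hPl l, rfl⟩).trans (le_abs_self _)) (hp.1 l)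
    _ ≤ |g l| := mul_le_of_le_one_left (abs_nonneg _) hp1

/-- Strong duality for a fixed first-stage decision. -/
theorem exists_conicFeasible_le_add (hy : y ∈ D.Y) (hXi : ∀ l, IsCompact (D.Xi l))
    (hrho : 0 ≤ D.rho) (hh : ∀ l, ContinuousOn (D.h y) (D.Xi l)) (hc : ∀ l, 0 ≤ D.phat y l)
    (hc1 : ∑ l, D.phat y l = 1)
    (hU : ∀ l, (D.relInteriorAmbiguitySet l y).Nonempty ∨
      ((∀ m, ContinuousOn (D.f m) (D.Xi l)) ∧ (D.ambiguitySet l y).Nonempty))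
    {v : ℝ} (hv : IsLUB (D.expectedCosts y) v) {ε : ℝ} (hε : 0 < ε) :
    ∃ z, D.ConicFeasible y z ∧ D.conicObjective y z ≤ D.c ⬝ᵥ y + v + ε := by
  have hne : ∀ l, (D.ambiguitySet l y).Nonempty := fun l =>
    (hU l).elim (fun ⟨P, hP⟩ => ⟨P, hP.1⟩) And.right
  choose g hg using fun l => exists_isLUB_integral (hXi l) (hh l) (hne l)
  have hgle : ∀ l, ∀ P ∈ D.ambiguitySet l y, ∫ ξ, D.h y ξ ∂P ≤ g l := fun l P hP =>
    (hg l).1 ⟨P, hP, rfl⟩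
  have hε2 : 0 < ε / 2 := by positivity
  -- Half of `ε` is spent on the moment duals, which raises `p ⬝ᵥ g` by `ε / 2`, and half on the
  -- `χ²` dual.
  let G : Fin L → ℝ := g + fun _ => ε / 2
  have hmom : ∀ l, ∃ α βlo βhi,
      D.MomentDualFeasible l y (D.h y) (G l) α βlo βhi := by
    intro l
    rcases hU l with hrel | ⟨hf, -⟩
    · exact exists_momentDualFeasible_of_relInterior (hXi l) (hh l) hrel fun P hP =>
        (hgle l P hP).trans (le_add_of_nonneg_right hε2.le)
    · exact exists_momentDualFeasible_of_continuousOn (hXi l) (hh l) hf (hne l) (hgle l) hε2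
  choose α βlo βhi hm using hmom
  obtain ⟨lam, eta, r, hχ, hle⟩ := exists_chiSquareDualFeasible_lt
    (g := G) (v := v + ε / 2) hc hc1 hrho (fun p hp => by
      have h1 := dotProduct_le_of_expectedCosts_le hXi hh hg hv.1 hp
      have h2 : (p ⬝ᵥ fun _ => ε / 2) = ε / 2 := by
        simp only [dotProduct, ← Finset.sum_mul, hp.2.1, one_mul]
      simp only [G, dotProduct_add, h2]
      linarith) hε2
  refine ⟨_, ConicFeasible.of_duals hy hχ hm, ?_⟩
  rw [conicObjective]
  linarith

/-- Strong duality with dual attainment for a fixed first-stage decision, under the relative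
interior condition. -/
theorem exists_conicFeasible_le (hy : y ∈ D.Y) (hXi : ∀ l, IsCompact (D.Xi l))
    (hrho : 0 < D.rho) (hh : ∀ l, ContinuousOn (D.h y) (D.Xi l)) (hc : ∀ l, 0 ≤ D.phat y l)
    (hc1 : ∑ l, D.phat y l = 1) (hU : ∀ l, (D.relInteriorAmbiguitySet l y).Nonempty)
    {v : ℝ} (hv : IsLUB (D.expectedCosts y) v) :
    ∃ z, D.ConicFeasible y z ∧ D.conicObjective y z ≤ D.c ⬝ᵥ y + v := by
  choose g hg using fun l => exists_isLUB_integral (hXi l) (hh l) ((hU l).imp fun _ hP => hP.1)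
  choose α βlo βhi hm using fun l => exists_momentDualFeasible_of_relInterior (hXi l) (hh l) (hU l)
    fun P hP => (hg l).1 ⟨P, hP, rfl⟩
  obtain ⟨lam, eta, r, hχ, hle⟩ := exists_chiSquareDualFeasible_of_pos hc hc1 hrho
    fun p hp => dotProduct_le_of_expectedCosts_le hXi hh hg hv.1 hp
  refine ⟨_, ConicFeasible.of_duals hy hχ hm, ?_⟩
  rw [conicObjective]
  linarith

theorem modelObjective_eq {v : ℝ} (hne : (D.expectedCosts y).Nonempty)
    (hv : IsLUB (D.expectedCosts y) v) : D.modelObjective y = ((D.c ⬝ᵥ y + v : ℝ) : EReal) := by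
  rw [modelObjective, hv.iSup_coe_ereal hne, EReal.coe_add]

end FixedDecision

end D3RO

/-! ### Equivalence of the two problems -/

theorem theorem5 {I J N S L M : ℕ} (D : D3RO I J N S L M)
    (hXi : ∀ l, IsCompact (D.Xi l))
    (hrho : 0 ≤ D.rho)
    (hphat_nonneg : ∀ y ∈ D.Y, ∀ l, 0 ≤ D.phat y l)
    (hphat_sum : ∀ y ∈ D.Y, ∑ l, D.phat y l = 1)
    (hrecourse : ∀ y ∈ D.Y, ∀ l, ∀ ξ ∈ D.Xi l, (D.secondStageSet y ξ).Nonempty)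
    (hfinite : ∀ y ∈ D.Y, ∀ l, ∀ ξ ∈ D.Xi l,
      BddBelow (D.secondStageCost ξ '' D.secondStageSet y ξ))
    (hU : ∀ y ∈ D.Y, ∀ l, (D.relInteriorAmbiguitySet l y).Nonempty ∨
      ((∀ m, ContinuousOn (D.f m) (D.Xi l)) ∧ (D.ambiguitySet l y).Nonempty)) :
    -- for each first-stage decision, the finite worst-case cost is the optimal conic value
    (∀ y ∈ D.Y, ∃ v : ℝ, IsLUB (D.expectedCosts y) v ∧
      IsGLB {t : ℝ | ∃ z, D.ConicFeasible y z ∧ t = D.conicObjective y z} (D.c ⬝ᵥ y + v)) ∧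
    -- the two problems have the same optimal value
    (⨅ y ∈ D.Y, D.modelObjective y) =
      (⨅ (y : Fin I → ℝ) (z : D3RO.ConicVars L M) (_ : D.ConicFeasible y z),
        ((D.conicObjective y z : ℝ) : EReal)) ∧
    -- optimal solutions of the conic problem give optimal first-stage decisions
    (∀ y z, D.IsConicOptimal y z → D.IsModelOptimal y) ∧
    -- the inner minimum is attained under the relative interior condition, for positive `ρ`
    (0 < D.rho → ∀ y ∈ D.Y, (∀ l, (D.relInteriorAmbiguitySet l y).Nonempty) →
      (∃ z, D.ConicFeasible y z ∧ ((D.conicObjective y z : ℝ) : EReal) = D.modelObjective y) ∧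
      (D.IsModelOptimal y ↔ ∃ z, D.IsConicOptimal y z)) := by
  have hh : ∀ y ∈ D.Y, ∀ l, ContinuousOn (D.h y) (D.Xi l) := fun y hy l =>
    D.continuousOn_h (hrecourse y hy l) (hfinite y hy l)
  have hne : ∀ y ∈ D.Y, ∀ l, (D.ambiguitySet l y).Nonempty := fun y hy l =>
    (hU y hy l).elim (fun ⟨P, hP⟩ => ⟨P, hP.1⟩) And.right
  have hfin : ∀ y ∈ D.Y, ∃ v : ℝ, IsLUB (D.expectedCosts y) v ∧
      D.modelObjective y = ((D.c ⬝ᵥ y + v : ℝ) : EReal) ∧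
      IsGLB {t : ℝ | ∃ z, D.ConicFeasible y z ∧ t = D.conicObjective y z} (D.c ⬝ᵥ y + v) := by
    intro y hy
    obtain ⟨hne', v, hv⟩ := D3RO.exists_isLUB_expectedCosts hXi hrho (hh y hy)
      (hphat_nonneg y hy) (hphat_sum y hy) (hne y hy)
    refine ⟨v, hv, D3RO.modelObjective_eq hne' hv, ?_, fun b hb => ?_⟩
    · rintro _ ⟨z, hz, rfl⟩
      rw [← le_sub_iff_add_le']
      exact hv.2 fun t ht => le_sub_iff_add_le'.2
        (hz.expectedCost_le hXi (hh y hy) (hphat_nonneg y hy) (hphat_sum y hy) ht)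
    · refine le_of_forall_pos_le_add fun ε hε => ?_
      obtain ⟨z, hz, hle⟩ := D3RO.exists_conicFeasible_le_add hy hXi hrho (hh y hy)
        (hphat_nonneg y hy) (hphat_sum y hy) (hU y hy) hv hε
      exact (hb ⟨z, hz, rfl⟩).trans hle
  have hweak : ∀ y z, D.ConicFeasible y z →
      D.modelObjective y ≤ ((D.conicObjective y z : ℝ) : EReal) := by
    intro y z hz
    obtain ⟨v, -, hmodel, hglb⟩ := hfin y hz.mem
    rw [hmodel]
    exact EReal.coe_le_coe_iff.2 (hglb.1 ⟨z, hz, rfl⟩)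
  have hopt : ∀ y z, D.IsConicOptimal y z → D.IsModelOptimal y := by
    refine fun y z hyz => ⟨hyz.1.mem, fun y' hy' => ?_⟩
    obtain ⟨v, -, hmodel, hglb⟩ := hfin y' hy'
    refine (hweak y z hyz.1).trans ?_
    rw [hmodel]
    refine EReal.coe_le_coe_iff.2 (hglb.2 ?_)
    rintro _ ⟨z', hz', rfl⟩
    exact hyz.2 y' z' hz'
  refine ⟨fun y hy => ?_, le_antisymm ?_ ?_, hopt, fun hpos y hy hrel => ?_⟩
  · obtain ⟨v, hv, -, hglb⟩ := hfin y hy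
    exact ⟨v, hv, hglb⟩
  · exact le_iInf fun y => le_iInf₂ fun z hz => (iInf₂_le y hz.mem).trans (hweak y z hz)
  · refine le_iInf₂ fun y hy => ?_
    obtain ⟨v, hv, hmodel, -⟩ := hfin y hy
    rw [hmodel]
    -- It suffices to treat reals `t` above the model value; the excess of `t` is the accuracy
    -- required of the conic solution.
    refine EReal.le_of_forall_lt_iff_le.1 fun t ht => ?_
    obtain ⟨z, hz, hle⟩ := D3RO.exists_conicFeasible_le_add hy hXi hrho (hh y hy)
      (hphat_nonneg y hy) (hphat_sum y hy) (hU y hy) hv (sub_pos.2 (EReal.coe_lt_coe_iff.1 ht))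
    refine (iInf_le _ y).trans ((iInf₂_le z hz).trans (EReal.coe_le_coe_iff.2 ?_))
    linarith
  · obtain ⟨v, hv, hmodel, -⟩ := hfin y hy
    obtain ⟨z, hz, hle⟩ := D3RO.exists_conicFeasible_le hy hXi hpos (hh y hy)
      (hphat_nonneg y hy) (hphat_sum y hy) hrel hv
    have heq : ((D.conicObjective y z : ℝ) : EReal) = D.modelObjective y :=
      le_antisymm (hmodel ▸ EReal.coe_le_coe_iff.2 hle) (hweak y z hz)
    refine ⟨⟨z, hz, heq⟩, fun hy' => ⟨z, hz, fun y' z' hz' => ?_⟩, fun ⟨z', hz'⟩ => hopt y z' hz'⟩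
    rw [← EReal.coe_le_coe_iff, heq]
    exact (hy'.2 y' hz'.mem).trans (hweak y' z' hz')
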